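/- For $1\le p\le\infty$ and a sequence $\beta=(\beta_n)_{n\ge 0}$ of positive numbers with $\liminf_{n\to\infty}\beta_n^{1/n}\ge 1$ (the lower limit may be $+\infty$), let $h^p(\beta)$ be the space of all analytic functions $f(z)=\sum_{n\ge 0}a_nz^n$ on the open unit disk $\mathbb D$ whose norm is finite, where $$\|f\|=\Big(\sum_{n=0}^\infty |a_n|^p\beta_n\Big)^{1/p}\quad (1\le p<\infty),\qquad \|f\|=\sup_{n\ge 0}|a_n|\,\beta_n\quad (p=\infty).$$ Write $h^p=\ell^p_A$ for $h^p(\beta)$ with $\beta_n=1$ for all $n$. For $a\in\mathbb D$ let $T_a(z)=\dfrac{a+z}{1+\bar a z}$ and $C_{T_a}f=f\circ T_a$. **Theorem.** Let $p\in[1,\infty]$ with $p\ne 2$. Then, for every $a\in\mathbb D\setminus\{0\}$, $C_{T_a}$ is not a bounded operator from $h^p$ to itself. Moreover, for every $\beta$ as above and every $a\in\mathbb D\setminus\{0\}$, $C_{T_a}$ is not a bounded operator from $h^p(\beta)$ to itself; that is, there is no constant $C<\infty$ such that $f\circ T_a\in h^p(\beta)$ and $\|f\circ T_a\|\le C\,\|f\|$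 for all $f\in h^p(\beta)$. -/

import Mathlib

open scoped ENNReal NNReal

noncomputable section

namespace BeurlingSobolev

/-- The `n`-th Taylor coefficient at the origin of `f`. -/
def taylorCoeff (f : ℂ → ℂ) (n : ℕ) : ℂ :=
  iteratedDeriv n f 0 / (n.factorial : ℂ)

/-- The norm of `f(z) = ∑ aₙ zⁿ` in the weighted Beurling–Sobolev space `h^p(β)`, with values
in `[0, ∞]`: it is `(∑ |aₙ|^p βₙ)^{1/p}` for `p < ∞` and `sup |aₙ| βₙ` for `p = ∞`. -/
def bsNorm (p : ℝ≥0∞) (β : ℕ → ℝ) (f : ℂ → ℂ) : ℝ≥0∞ :=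
  if p = ∞ then ⨆ n : ℕ, ‖taylorCoeff f n‖ₑ * ENNReal.ofReal (β n)
  else (∑' n : ℕ, ‖taylorCoeff f n‖ₑ ^ p.toReal * ENNReal.ofReal (β n)) ^ (1 / p.toReal)

/-- Membership in `h^p(β)`: `f` is analytic on the open unit disk and its norm is finite.
The values of `f` outside the disk play no role. -/
def MemBS (p : ℝ≥0∞) (β : ℕ → ℝ) (f : ℂ → ℂ) : Prop :=
  DifferentiableOn ℂ f (Metric.ball 0 1) ∧ bsNorm p β f < ∞

/-- `φ` induces a bounded composition operator `f ↦ f ∘ φ` from `h^p(β)` to itself. -/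
def InducesBoundedComp (p : ℝ≥0∞) (β : ℕ → ℝ) (φ : ℂ → ℂ) : Prop :=
  ∃ C : ℝ≥0, ∀ f : ℂ → ℂ, MemBS p β f →
    MemBS p β (f ∘ φ) ∧ bsNorm p β (f ∘ φ) ≤ (C : ℝ≥0∞) * bsNorm p β f

/-- The disk automorphism `T_a(z) = (a + z) / (1 + ā z)`. -/
def diskAut (a : ℂ) (z : ℂ) : ℂ := (a + z) / (1 + (starRingEnd ℂ) a * z)

/-- The standing assumption on a weight: `βₙ > 0` for all `n` and `liminf βₙ^{1/n} ≥ 1`. The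
lower limit is taken in `[0, ∞]`, so that it may be infinite. -/
def IsWeight (β : ℕ → ℝ) : Prop :=
  (∀ n, 0 < β n) ∧
    1 ≤ Filter.liminf (fun n : ℕ => ENNReal.ofReal (β n ^ (1 / (n : ℝ)))) Filter.atTop

end BeurlingSobolev

end

namespace BeurlingSobolev

open PowerSeries

/-! ### Absolutely convergent power series -/

/-! A rotation reduces the problem to `a = r` in (0, 1). The operator then acts on Taylor
coefficients by the real matrix A(m, n) = `autCoeff r m n`, whose n-th column lists the coefficients
of T^n, with T = (r + z)/(1 + rz). These columns are unit vectors in ℓ², but their mass is spread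
over many small entries, so their ℓ^q sums blow up for q < 2.

Two facts make this quantitative. Column n, squared, is a probability distribution with mean n and
variance (s - 1)n², where s > 1. With exponential tails, this puts a fixed mass just above n and a
fixed mass just below n (`exists_le_sum_autCoeff_sq`). Also, A(m, n) tends to 0 as m → ∞, uniformly
for n ≤ Rm (`exists_abs_autCoeff_le`): a large entry would propagate, through an approximate
Chebyshev recurrence, to too many neighbours. Since |A|^q ≥ ε^(q-2) A² where |A| ≤ ε, all column
sums of |A|^q over a block [L, M²L] are large. The symmetry m|A(m, n)| = n|A(n, m)| transfers this
to the rows (`exists_finset_le_sum_rpow`).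

Boundedness on h^p(β) gives weighted inequalities of Schur type for |A|^q on the block, with q = p
for p < 2 and q the conjugate exponent for p > 2. Summing them over the block eliminates the weight
and contradicts the large sums (`not_forall_sum_mul_le`). -/

/-- The power series `f` converges absolutely at `ρ`. -/
def AbsConv (ρ : ℝ) (f : PowerSeries ℝ) : Prop :=
  Summable fun m => |coeff m f| * ρ ^ m

/-- The sum `∑ |fₘ| ρ ^ m`. -/
noncomputable def absNorm (ρ : ℝ) (f : PowerSeries ℝ) : ℝ :=
  ∑' m, |coeff m f| * ρ ^ m

/-- The bilinear form `∑ fₘ gₘ`. -/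
noncomputable def pairing (f g : PowerSeries ℝ) : ℝ :=
  ∑' m, coeff m f * coeff m g

lemma abs_coeff_mul_pow_le {ρ : ℝ} (hρ : 0 ≤ ρ) (f g : PowerSeries ℝ) (m : ℕ) :
    |coeff m (f * g)| * ρ ^ m ≤ ∑ p ∈ Finset.HasAntidiagonal.antidiagonal m,
      (|coeff p.1 f| * ρ ^ p.1) * (|coeff p.2 g| * ρ ^ p.2) := by
  rw [coeff_mul]
  calc _ ≤ (∑ p ∈ Finset.HasAntidiagonal.antidiagonal m, |coeff p.1 f * coeff p.2 g|) * ρ ^ m := by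
        gcongr
        exact Finset.abs_sum_le_sum_abs _ _
    _ = _ := by
        rw [Finset.sum_mul]
        refine Finset.sum_congr rfl fun p hp => ?_
        rw [← Finset.HasAntidiagonal.mem_antidiagonal.1 hp, abs_mul, pow_add]
        ring

lemma AbsConv.norm {ρ : ℝ} {f : PowerSeries ℝ} (hf : AbsConv ρ f) :
    Summable fun m => ‖|coeff m f| * ρ ^ m‖ :=
  Summable.norm hf

lemma AbsConv.mul {ρ : ℝ} (hρ : 0 ≤ ρ) {f g : PowerSeries ℝ} (hf : AbsConv ρ f)
    (hg : AbsConv ρ g) : AbsConv ρ (f * g) :=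
  Summable.of_nonneg_of_le (fun m => by positivity) (abs_coeff_mul_pow_le hρ f g)
    (summable_norm_sum_mul_antidiagonal_of_summable_norm hf.norm hg.norm).of_norm

lemma absNorm_mul_le {ρ : ℝ} (hρ : 0 ≤ ρ) {f g : PowerSeries ℝ} (hf : AbsConv ρ f)
    (hg : AbsConv ρ g) : absNorm ρ (f * g) ≤ absNorm ρ f * absNorm ρ g := by
  unfold absNorm
  rw [tsum_mul_tsum_eq_tsum_sum_antidiagonal_of_summable_norm hf.norm hg.norm]
  exact Summable.tsum_le_tsum (abs_coeff_mul_pow_le hρ f g) (hf.mul hρ hg)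
    (summable_norm_sum_mul_antidiagonal_of_summable_norm hf.norm hg.norm).of_norm

lemma absConv_one (ρ : ℝ) : AbsConv ρ 1 := by
  refine summable_of_ne_finset_zero (s := {0}) fun m hm => ?_
  rw [coeff_one, if_neg (by simpa using hm)]
  simp

lemma absConv_C (ρ r : ℝ) : AbsConv ρ (C r) := by
  refine summable_of_ne_finset_zero (s := {0}) fun m hm => ?_
  rw [coeff_C, if_neg (by simpa using hm)]
  simp

lemma absConv_X (ρ : ℝ) : AbsConv ρ X := by
  refine summable_of_ne_finset_zero (s := {1}) fun m hm => ?_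
  rw [coeff_X, if_neg (by simpa using hm)]
  simp

lemma AbsConv.add {ρ : ℝ} (hρ : 0 ≤ ρ) {f g : PowerSeries ℝ} (hf : AbsConv ρ f)
    (hg : AbsConv ρ g) : AbsConv ρ (f + g) := by
  refine Summable.of_nonneg_of_le (fun m => by positivity) (fun m => ?_) (Summable.add hf hg)
  rw [map_add, ← add_mul]
  gcongr
  exact abs_add_le _ _

lemma AbsConv.pow {ρ : ℝ} (hρ : 0 ≤ ρ) {f : PowerSeries ℝ} (hf : AbsConv ρ f) (n : ℕ) :
    AbsConv ρ (f ^ n) := by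
  induction n with
  | zero => simpa using absConv_one ρ
  | succ n ih => rw [pow_succ]; exact ih.mul hρ hf

lemma absNorm_one (ρ : ℝ) : absNorm ρ 1 = 1 := by
  unfold absNorm
  rw [tsum_eq_single 0]
  · simp
  · intro m hm
    rw [coeff_one, if_neg hm]
    simp

lemma absNorm_nonneg {ρ : ℝ} (hρ : 0 ≤ ρ) (f : PowerSeries ℝ) : 0 ≤ absNorm ρ f :=
  tsum_nonneg fun _ => by positivity

lemma absNorm_pow_le {ρ : ℝ} (hρ : 0 ≤ ρ) {f : PowerSeries ℝ} (hf : AbsConv ρ f) (n : ℕ) :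
    absNorm ρ (f ^ n) ≤ absNorm ρ f ^ n := by
  induction n with
  | zero => simp [absNorm_one]
  | succ n ih =>
    rw [pow_succ, pow_succ]
    exact (absNorm_mul_le hρ (hf.pow hρ n) hf).trans
      (mul_le_mul_of_nonneg_right ih (absNorm_nonneg hρ f))

lemma AbsConv.abs_coeff_le {ρ : ℝ} (hρ : 0 ≤ ρ) {f : PowerSeries ℝ} (hf : AbsConv ρ f) (m : ℕ) :
    |coeff m f| * ρ ^ m ≤ absNorm ρ f :=
  hf.le_tsum m fun _ _ => by positivity

lemma AbsConv.abs_le {ρ : ℝ} (hρ : 1 ≤ ρ) {f : PowerSeries ℝ} (hf : AbsConv ρ f) (m : ℕ) :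
    |coeff m f| ≤ absNorm ρ f :=
  (le_mul_of_one_le_right (abs_nonneg _) (one_le_pow₀ hρ)).trans
    (hf.abs_coeff_le (zero_le_one.trans hρ) m)

lemma AbsConv.summable_abs {ρ : ℝ} (hρ : 1 ≤ ρ) {f : PowerSeries ℝ} (hf : AbsConv ρ f) :
    Summable fun m => |coeff m f| :=
  Summable.of_nonneg_of_le (fun _ => abs_nonneg _)
    (fun _ => le_mul_of_one_le_right (abs_nonneg _) (one_le_pow₀ hρ)) hf

lemma AbsConv.summable_mul {ρ : ℝ} (hρ : 1 ≤ ρ) {f g : PowerSeries ℝ} (hf : AbsConv ρ f)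
    (hg : AbsConv ρ g) : Summable fun m => coeff m f * coeff m g := by
  refine Summable.of_norm_bounded ((hf.summable_abs hρ).mul_right (absNorm ρ g)) fun m => ?_
  rw [Real.norm_eq_abs, abs_mul]
  gcongr
  exact hg.abs_le hρ m

lemma AbsConv.hasSum_mul {ρ : ℝ} (hρ : 1 ≤ ρ) {f g : PowerSeries ℝ} (hf : AbsConv ρ f)
    (hg : AbsConv ρ g) : HasSum (fun m => coeff m f * coeff m g) (pairing f g) :=
  (hf.summable_mul hρ hg).hasSum

lemma pairing_C_mul (c : ℝ) (f g : PowerSeries ℝ) : pairing (C c * f) g = c * pairing f g := by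
  unfold pairing
  rw [← tsum_mul_left]
  simp [mul_assoc]

lemma pairing_comm (f g : PowerSeries ℝ) : pairing f g = pairing g f := by
  simp [pairing, mul_comm]

lemma pairing_add {ρ : ℝ} (hρ : 1 ≤ ρ) {f g h : PowerSeries ℝ} (hf : AbsConv ρ f)
    (hg : AbsConv ρ g) (hh : AbsConv ρ h) : pairing (f + g) h = pairing f h + pairing g h := by
  unfold pairing
  rw [← (hf.summable_mul hρ hh).tsum_add (hg.summable_mul hρ hh)]
  simp [add_mul]

lemma pairing_X_mul {ρ : ℝ} (hρ : 1 ≤ ρ) {f g : PowerSeries ℝ} (hf : AbsConv ρ f)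
    (hg : AbsConv ρ g) : pairing (X * f) (X * g) = pairing f g := by
  have h0 : (0 : ℝ) ≤ ρ := zero_le_one.trans hρ
  unfold pairing
  rw [(((absConv_X ρ).mul h0 hf).summable_mul hρ ((absConv_X ρ).mul h0 hg)).tsum_eq_zero_add]
  simp [coeff_succ_X_mul]

/-- Multiplication by `X + r` and multiplication by `1 + rX` give the same pairings. -/
lemma pairing_add_X_mul {ρ : ℝ} (hρ : 1 ≤ ρ) (r : ℝ) {f g : PowerSeries ℝ} (hf : AbsConv ρ f)
    (hg : AbsConv ρ g) :
    pairing ((C r + X) * f) ((C r + X) * g) = pairing ((1 + C r * X) * f) ((1 + C r * X) * g) := by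
  have h0 : (0 : ℝ) ≤ ρ := zero_le_one.trans hρ
  have hXf := (absConv_X ρ).mul h0 hf
  have hXg := (absConv_X ρ).mul h0 hg
  have hCf := (absConv_C ρ r).mul h0 hf
  have hCg := (absConv_C ρ r).mul h0 hg
  have hCXf := (absConv_C ρ r).mul h0 hXf
  have hCXg := (absConv_C ρ r).mul h0 hXg
  have hS := pairing_X_mul hρ hf hg
  -- On the unit circle |r + z| = |1 + rz|. Algebraically, both sides expand to (1 + r²)⟨f, g⟩ +
  -- r(⟨Xf, g⟩ + ⟨f, Xg⟩), since the shift preserves the pairing.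
  simp only [add_mul, one_mul, mul_assoc]
  rw [pairing_add hρ hCf hXf (hCg.add h0 hXg), pairing_add hρ hf hCXf (hg.add h0 hCXg),
    pairing_comm (C r * f), pairing_comm (X * f), pairing_comm f, pairing_comm (C r * (X * f)),
    pairing_add hρ hCg hXg hCf, pairing_add hρ hCg hXg hXf, pairing_add hρ hg hCXg hf,
    pairing_add hρ hg hCXg hCXf]
  simp only [pairing_C_mul]
  rw [pairing_comm _ (C r * f), pairing_comm _ (C r * f), pairing_comm _ (C r * (X * f)),
    pairing_comm _ (C r * (X * f))]
  simp only [pairing_C_mul]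
  rw [pairing_comm (X * g) (X * f), hS, pairing_comm (X * f) g, pairing_comm (X * g) f,
    pairing_comm f g]
  ring

/-! ### The Taylor series of `(r + z) / (1 + r z)` -/

/-- The power series `1 / (1 + r X)`. -/
noncomputable def geomSeries (r : ℝ) : PowerSeries ℝ := PowerSeries.mk fun k => (-r) ^ k

/-- The power series `(r + X) / (1 + r X)`. -/
noncomputable def autSeries (r : ℝ) : PowerSeries ℝ := C r + (1 - C r ^ 2) * (X * geomSeries r)

/-- The `m`-th coefficient of the `n`-th power of `(r + X) / (1 + r X)`. -/
noncomputable def autCoeff (r : ℝ) (m n : ℕ) : ℝ := coeff m (autSeries r ^ n)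

lemma one_add_mul_geomSeries (r : ℝ) : (1 + C r * X) * geomSeries r = 1 := by
  ext m
  rw [add_mul, one_mul, mul_assoc, map_add, coeff_C_mul]
  cases m with
  | zero => simp [geomSeries]
  | succ m =>
    rw [coeff_succ_X_mul, coeff_one, if_neg (Nat.succ_ne_zero m)]
    simp only [geomSeries, coeff_mk]
    ring

lemma one_add_mul_autSeries (r : ℝ) : (1 + C r * X) * autSeries r = C r + X := by
  have h := one_add_mul_geomSeries r
  unfold autSeries
  linear_combination (1 - C r ^ 2) * X * h

lemma autSeries_eq (r : ℝ) : autSeries r = (C r + X) * geomSeries r := by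
  have h := one_add_mul_geomSeries r
  have h' := one_add_mul_autSeries r
  linear_combination (- autSeries r) * h + geomSeries r * h'

lemma derivative_geomSeries (r : ℝ) :
    d⁄dX ℝ (geomSeries r) = - C r * geomSeries r ^ 2 := by
  have h := one_add_mul_geomSeries r
  have h' := congrArg (d⁄dX ℝ) h
  simp only [Derivation.leibniz, map_add, derivative_C, derivative_X, smul_eq_mul,
    Derivation.map_one_eq_zero] at h'
  linear_combination (- d⁄dX ℝ (geomSeries r)) * h + geomSeries r * h'

lemma derivative_autSeries (r : ℝ) :
    d⁄dX ℝ (autSeries r) = (1 - C r ^ 2) * geomSeries r ^ 2 := by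
  have h := one_add_mul_geomSeries r
  have hc : d⁄dX ℝ ((1 : PowerSeries ℝ) - C r ^ 2) = 0 := by
    rw [← map_pow, map_sub, derivative_C, Derivation.map_one_eq_zero, sub_zero]
  unfold autSeries
  rw [map_add, derivative_C, Derivation.leibniz, hc, Derivation.leibniz, derivative_geomSeries,
    derivative_X]
  simp only [smul_eq_mul]
  linear_combination (- (1 - C r ^ 2) * geomSeries r) * h

/-- The differential equation of `(r + X) / (1 + r X)` and its powers. -/
lemma derivative_autSeries_pow (r : ℝ) (n : ℕ) :
    (C r + (1 + C r ^ 2) * X + C r * X ^ 2) * d⁄dX ℝ (autSeries r ^ n) =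
      (n : PowerSeries ℝ) * ((1 - C r ^ 2) * autSeries r ^ n) := by
  have h := one_add_mul_geomSeries r
  have h' := autSeries_eq r
  rw [Derivation.leibniz_pow, derivative_autSeries]
  simp only [smul_eq_mul, nsmul_eq_mul]
  cases n with
  | zero => simp
  | succ n =>
    rw [Nat.add_sub_cancel, pow_succ]
    -- The quadratic factors as (r + X)(1 + rX).
    have key : (C r + (1 + C r ^ 2) * X + C r * X ^ 2) * geomSeries r ^ 2 = autSeries r := by
      rw [h']
      linear_combination ((C r + X) * geomSeries r) * h
    linear_combination ((n + 1 : ℕ) : PowerSeries ℝ) * autSeries r ^ n * (1 - C r ^ 2) * key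

/-- This compares coefficients in the differential equation. In terms of u_j = j A(j, n) the two
outer terms have the same factor r, which is what makes reflection about an index useful later. -/
lemma autCoeff_recurrence (r : ℝ) (m n : ℕ) :
    r * ((m + 2) * autCoeff r (m + 2) n) + (1 + r ^ 2) * ((m + 1) * autCoeff r (m + 1) n) +
      r * (m * autCoeff r m n) = n * (1 - r ^ 2) * autCoeff r (m + 1) n := by
  have h := congrArg (coeff (m + 1)) (derivative_autSeries_pow r n)
  have e1 : (C r + (1 + C r ^ 2) * X + C r * X ^ 2) * d⁄dX ℝ (autSeries r ^ n) =
      C r * d⁄dX ℝ (autSeries r ^ n) + C (1 + r ^ 2) * (X * d⁄dX ℝ (autSeries r ^ n)) +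
      C r * (X * (X * d⁄dX ℝ (autSeries r ^ n))) := by
    simp only [map_add, map_one, map_pow]; ring
  have e2 : (n : PowerSeries ℝ) * ((1 - C r ^ 2) * autSeries r ^ n) =
      C (n * (1 - r ^ 2)) * autSeries r ^ n := by
    simp only [map_mul, map_sub, map_one, map_pow, map_natCast]; ring
  rw [e1, e2, map_add, map_add, coeff_C_mul, coeff_C_mul, coeff_C_mul, coeff_C_mul,
    coeff_succ_X_mul, coeff_succ_X_mul, coeff_derivative, coeff_derivative] at h
  have e3 : coeff m (X * d⁄dX ℝ (autSeries r ^ n)) = m * autCoeff r m n := by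
    cases m with
    | zero => simp
    | succ m =>
      rw [coeff_succ_X_mul, coeff_derivative, autCoeff]
      push_cast; ring
  rw [e3] at h
  simp only [autCoeff] at h ⊢
  push_cast at h
  linear_combination h

/-! ### Symmetry -/

/-- The relation `step` turns into Pascal's rule for the coefficients. -/
lemma coeff_X_mul_geomSeries_pow (r : ℝ) (j m : ℕ) :
    coeff (m + 1) ((X * geomSeries r) ^ (j + 1)) = m.choose j * (-r) ^ (m - j) := by
  have step : ∀ j, (X * geomSeries r) ^ (j + 1) =
      X * (X * geomSeries r) ^ j - C r * (X * (X * geomSeries r) ^ (j + 1)) := fun j => by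
    have h := one_add_mul_geomSeries r
    linear_combination (X * (X * geomSeries r) ^ j) * h
  induction m generalizing j with
  | zero =>
    rw [step, map_sub, coeff_C_mul, coeff_succ_X_mul, coeff_succ_X_mul]
    cases j <;> simp
  | succ m ih =>
    rw [step, map_sub, coeff_C_mul, coeff_succ_X_mul, coeff_succ_X_mul, ih]
    cases j with
    | zero =>
      rw [pow_zero, coeff_one, if_neg (Nat.succ_ne_zero m)]
      simp [pow_succ]; ring
    | succ j =>
      rw [ih, Nat.choose_succ_succ]
      rcases lt_trichotomy m j with h | h | h
      · simp [Nat.choose_eq_zero_of_lt h, Nat.choose_eq_zero_of_lt (h.trans (Nat.lt_succ_self j))]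
      · subst h; simp
      · obtain ⟨k, rfl⟩ := Nat.exists_eq_add_of_lt h
        rw [show j + k + 1 - j = k + 1 by omega, show j + k + 1 - (j + 1) = k by omega,
          show j + k + 1 + 1 - (j + 1) = k + 1 by omega]
        push_cast; ring

lemma mul_coeff_X_mul_geomSeries_pow (r : ℝ) (j m : ℕ) :
    m * coeff m ((X * geomSeries r) ^ j) = j * m.choose j * (-r) ^ (m - j) := by
  rcases m with _ | m
  · cases j <;> simp
  rcases j with _ | j
  · rw [pow_zero, coeff_one, if_neg (Nat.succ_ne_zero m)]; simp
  rw [coeff_X_mul_geomSeries_pow, Nat.add_sub_add_right, ← mul_assoc]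
  have := Nat.add_one_mul_choose_eq m j
  rw [← Nat.cast_mul, this]
  push_cast; ring

lemma mul_autCoeff_eq_sum (r : ℝ) (m n : ℕ) :
    m * autCoeff r m n = ∑ j ∈ Finset.range (n + 1),
      (1 - r ^ 2) ^ j * r ^ (n - j) * n.choose j * (j * m.choose j * (-r) ^ (m - j)) := by
  rw [autCoeff, autSeries, add_comm, add_pow, map_sum, Finset.mul_sum]
  refine Finset.sum_congr rfl fun j _ => ?_
  have : ((1 - C r ^ 2) * (X * geomSeries r)) ^ j * C r ^ (n - j) * ((n.choose j : ℕ) : PowerSeries ℝ)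
      = C ((1 - r ^ 2) ^ j * r ^ (n - j) * n.choose j) * (X * geomSeries r) ^ j := by
    simp only [map_mul, map_sub, map_one, map_pow, map_natCast, mul_pow]; ring
  rw [this, coeff_C_mul, ← mul_coeff_X_mul_geomSeries_pow]
  ring

lemma mul_autCoeff_eq_sum' (r : ℝ) {m n K : ℕ} (hK : n ≤ K) :
    m * autCoeff r m n = ∑ j ∈ Finset.range (K + 1),
      (1 - r ^ 2) ^ j * r ^ (n - j) * n.choose j * (j * m.choose j * (-r) ^ (m - j)) := by
  rw [mul_autCoeff_eq_sum]
  refine Finset.sum_subset (Finset.range_subset_range.2 (by omega)) fun j _ hj => ?_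
  rw [Nat.choose_eq_zero_of_lt (by simpa using hj)]
  simp

/-- Expanding T^n = (r + (1 - r²)X/(1 + rX))^n binomially gives a sum over j whose factor j·C(n,
j)·C(m, j) is symmetric in m and n. Only the powers of r and -r trade places, which costs the sign.
-/
lemma mul_autCoeff_swap (r : ℝ) (m n : ℕ) :
    m * autCoeff r m n = (-1) ^ (m + n) * (n * autCoeff r n m) := by
  rw [mul_autCoeff_eq_sum' r (le_max_right m n), mul_autCoeff_eq_sum' r (le_max_left m n),
    Finset.mul_sum]
  refine Finset.sum_congr rfl fun j _ => ?_
  rcases lt_or_ge m j with hm | hm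
  · simp [Nat.choose_eq_zero_of_lt hm]
  rcases lt_or_ge n j with hn | hn
  · simp [Nat.choose_eq_zero_of_lt hn]
  obtain ⟨s, rfl⟩ := Nat.exists_eq_add_of_le hm
  obtain ⟨t, rfl⟩ := Nat.exists_eq_add_of_le hn
  simp only [Nat.add_sub_cancel_left]
  rw [neg_pow r s, neg_pow r t, show j + s + (j + t) = 2 * j + s + t by ring, pow_add, pow_add,
    pow_mul]
  have h1 : ((-1 : ℝ) ^ t) * (-1) ^ t = 1 := by rw [← mul_pow]; simp
  simp only [neg_one_sq, one_pow, one_mul]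
  linear_combination (-((1 - r ^ 2) ^ j * r ^ t * (j + t).choose j * j * (j + s).choose j *
    (-1) ^ s * r ^ s)) * h1

lemma mul_abs_autCoeff_swap (r : ℝ) (m n : ℕ) :
    m * |autCoeff r m n| = n * |autCoeff r n m| := by
  have h := congrArg abs (mul_autCoeff_swap r m n)
  simpa [abs_mul, abs_pow] using h

/-! ### Moments -/

lemma absConv_geomSeries {r ρ : ℝ} (hr : 0 ≤ r) (hρ : 0 ≤ ρ) (h : r * ρ < 1) :
    AbsConv ρ (geomSeries r) := by
  have : (fun m => |coeff m (geomSeries r)| * ρ ^ m) = fun m => (r * ρ) ^ m := by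
    ext m
    simp [geomSeries, abs_pow, abs_of_nonneg hr, mul_pow]
  rw [AbsConv, this]
  exact summable_geometric_of_lt_one (by positivity) h

lemma absConv_autSeries {r ρ : ℝ} (hr : 0 ≤ r) (hρ : 0 ≤ ρ) (h : r * ρ < 1) :
    AbsConv ρ (autSeries r) := by
  rw [autSeries_eq]
  exact ((absConv_C ρ r).add hρ (absConv_X ρ)).mul hρ (absConv_geomSeries hr hρ h)

/-- T is unimodular on the circle, so multiplication by it is an ℓ² isometry. -/
lemma pairing_autSeries_mul {r ρ : ℝ} (hr : 0 ≤ r) (hρ : 1 ≤ ρ) (h : r * ρ < 1)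
    {f g : PowerSeries ℝ} (hf : AbsConv ρ f) (hg : AbsConv ρ g) :
    pairing (autSeries r * f) (autSeries r * g) = pairing f g := by
  have h0 : (0 : ℝ) ≤ ρ := zero_le_one.trans hρ
  have hG := absConv_geomSeries hr h0 h
  have := pairing_add_X_mul hρ r (hG.mul h0 hf) (hG.mul h0 hg)
  simpa only [← mul_assoc, ← autSeries_eq, one_add_mul_geomSeries, one_mul] using this

lemma pairing_autSeries_pow_mul {r ρ : ℝ} (hr : 0 ≤ r) (hρ : 1 ≤ ρ) (h : r * ρ < 1)
    {f g : PowerSeries ℝ} (hf : AbsConv ρ f) (hg : AbsConv ρ g) (n : ℕ) :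
    pairing (autSeries r ^ n * f) (autSeries r ^ n * g) = pairing f g := by
  have h0 : (0 : ℝ) ≤ ρ := zero_le_one.trans hρ
  induction n with
  | zero => simp
  | succ n ih =>
    have hT := (absConv_autSeries hr h0 h).pow h0 n
    rw [pow_succ', mul_assoc, mul_assoc, pairing_autSeries_mul hr hρ h (hT.mul h0 hf) (hT.mul h0 hg),
      ih]

lemma coeff_X_mul_derivative (f : PowerSeries ℝ) (m : ℕ) :
    coeff m (X * d⁄dX ℝ f) = m * coeff m f := by
  cases m with
  | zero => simp
  | succ m =>
    rw [coeff_succ_X_mul, coeff_derivative]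
    push_cast; ring

lemma X_mul_derivative_autSeries_pow (r : ℝ) (n : ℕ) :
    X * d⁄dX ℝ (autSeries r ^ (n + 1)) =
      C (n + 1 : ℝ) * (autSeries r ^ n * (X * d⁄dX ℝ (autSeries r))) := by
  rw [Derivation.leibniz_pow, Nat.add_sub_cancel]
  simp only [smul_eq_mul, nsmul_eq_mul, map_add, map_natCast, map_one, Nat.cast_add, Nat.cast_one]
  ring

lemma absConv_X_mul_derivative_autSeries {r ρ : ℝ} (hr : 0 ≤ r) (hρ : 0 ≤ ρ) (h : r * ρ < 1) :
    AbsConv ρ (X * d⁄dX ℝ (autSeries r)) := by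
  rw [derivative_autSeries]
  have : (1 : PowerSeries ℝ) - C r ^ 2 = C (1 - r ^ 2) := by simp
  rw [this]
  exact (absConv_X ρ).mul hρ ((absConv_C ρ _).mul hρ ((absConv_geomSeries hr hρ h).pow hρ 2))

lemma hasSum_autCoeff_sq {r ρ : ℝ} (hr : 0 ≤ r) (hρ : 1 ≤ ρ) (h : r * ρ < 1) (n : ℕ) :
    HasSum (fun m => autCoeff r m n ^ 2) 1 := by
  have h0 : (0 : ℝ) ≤ ρ := zero_le_one.trans hρ
  have hT := (absConv_autSeries hr h0 h).pow h0 n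
  have h1 := hT.hasSum_mul hρ hT
  have h2 := pairing_autSeries_pow_mul hr hρ h (absConv_one ρ) (absConv_one ρ) n
  rw [mul_one] at h2
  have h3 : pairing 1 1 = 1 := by
    rw [pairing, tsum_eq_single 0]
    · simp
    · intro m hm
      rw [coeff_one, if_neg hm]
      simp
  rw [h2, h3] at h1
  simpa only [autCoeff, sq] using h1

lemma coeff_autSeries_succ (r : ℝ) (m : ℕ) :
    coeff (m + 1) (autSeries r) = (1 - r ^ 2) * (-r) ^ m := by
  have : (1 : PowerSeries ℝ) - C r ^ 2 = C (1 - r ^ 2) := by simp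
  rw [autSeries, this, map_add, coeff_C_mul, coeff_succ_X_mul, coeff_C,
    if_neg (Nat.succ_ne_zero m)]
  simp [geomSeries]

lemma hasSum_mul_coeff_autSeries_sq {r : ℝ} (hr : 0 ≤ r) (hr1 : r < 1) :
    HasSum (fun m : ℕ => (m : ℝ) * coeff m (autSeries r) * coeff m (autSeries r)) 1 := by
  rw [← hasSum_nat_add_iff' 1]
  have hs : r ^ 2 < 1 := by nlinarith
  have h1 := hasSum_coe_mul_geometric_of_norm_lt_one (r := r ^ 2)
    (by rwa [Real.norm_of_nonneg (by positivity)])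
  have h2 := hasSum_geometric_of_lt_one (by positivity) hs
  have h3 := (h1.add h2).mul_left ((1 - r ^ 2) ^ 2)
  have hval : (1 - r ^ 2) ^ 2 * (r ^ 2 / (1 - r ^ 2) ^ 2 + (1 - r ^ 2)⁻¹) =
      1 - ∑ i ∈ Finset.range 1, (i : ℝ) * coeff i (autSeries r) * coeff i (autSeries r) := by
    have : 1 - r ^ 2 ≠ 0 := by linarith
    simp
    field_simp
    ring
  rw [hval] at h3
  refine Eq.mpr (congrArg (fun F : ℕ → ℝ => HasSum F _) (funext fun m => ?_)) h3
  rw [coeff_autSeries_succ, show (r ^ 2) ^ m = (-r) ^ m * (-r) ^ m by rw [← mul_pow]; ring]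
  push_cast; ring

/-- Multiplying the m-th coefficient by m is the operator X d/dX, and X(T^n)' = n T^(n-1) XT'. The
isometry cancels T^(n-1) and leaves n times the case n = 1. The second moment is computed in the
same way. -/
lemma hasSum_mul_autCoeff_sq {r ρ : ℝ} (hr : 0 ≤ r) (hρ : 1 < ρ) (h : r * ρ < 1) (n : ℕ) :
    HasSum (fun m : ℕ => m * autCoeff r m n ^ 2) n := by
  have h0 : (0 : ℝ) ≤ ρ := zero_le_one.trans hρ.le
  have hr1 : r < 1 := by nlinarith
  cases n with
  | zero =>
    convert hasSum_zero using 1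
    · ext m
      cases m with
      | zero => simp
      | succ m => simp [autCoeff, coeff_one]
    · simp
  | succ n =>
    have hT := absConv_autSeries hr h0 h
    have hD := absConv_X_mul_derivative_autSeries hr h0 h
    have hC := (absConv_C ρ (n + 1 : ℝ)).mul h0 ((hT.pow h0 n).mul h0 hD)
    have h1 := hC.hasSum_mul hρ.le (hT.pow h0 (n + 1))
    rw [pairing_C_mul, pow_succ, pairing_autSeries_pow_mul hr hρ.le h hD hT n] at h1
    have h2 : pairing (X * d⁄dX ℝ (autSeries r)) (autSeries r) = 1 := by
      simpa only [pairing, coeff_X_mul_derivative] using (hasSum_mul_coeff_autSeries_sq hr hr1).tsum_eq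
    rw [h2, mul_one, ← pow_succ, ← X_mul_derivative_autSeries_pow] at h1
    simp only [coeff_X_mul_derivative] at h1
    push_cast
    simpa only [autCoeff, sq, mul_assoc] using h1

/-- The second moment of the squared coefficients of `(r + X) / (1 + r X)`. -/
noncomputable def secondMoment (r : ℝ) : ℝ :=
  pairing (X * d⁄dX ℝ (autSeries r)) (X * d⁄dX ℝ (autSeries r))

lemma hasSum_sq_mul_autCoeff_sq {r ρ : ℝ} (hr : 0 ≤ r) (hρ : 1 < ρ) (h : r * ρ < 1) (n : ℕ) :
    HasSum (fun m : ℕ => m ^ 2 * autCoeff r m n ^ 2) (secondMoment r * n ^ 2) := by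
  have h0 : (0 : ℝ) ≤ ρ := zero_le_one.trans hρ.le
  cases n with
  | zero =>
    convert hasSum_zero using 1
    · ext m
      cases m with
      | zero => simp
      | succ m => simp [autCoeff, coeff_one]
    · simp
  | succ n =>
    have hT := absConv_autSeries hr h0 h
    have hD := absConv_X_mul_derivative_autSeries hr h0 h
    have hC := (absConv_C ρ (n + 1 : ℝ)).mul h0 ((hT.pow h0 n).mul h0 hD)
    have h1 := hC.hasSum_mul hρ.le hC
    rw [pairing_C_mul, pairing_comm _ (C _ * _), pairing_C_mul,
      pairing_autSeries_pow_mul hr hρ.le h hD hD n, ← X_mul_derivative_autSeries_pow] at h1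
    simp only [coeff_X_mul_derivative] at h1
    push_cast
    convert h1 using 1
    · ext m
      rw [autCoeff]; ring
    · rw [secondMoment]; ring

/-- Compare with the first moment for n = 1, using m ≤ m². The inequality is strict at m = 2, whose
coefficient is nonzero because r ≠ 0. -/
lemma one_lt_secondMoment {r ρ : ℝ} (hr : 0 < r) (hρ : 1 < ρ) (h : r * ρ < 1) :
    1 < secondMoment r := by
  have h0 : (0 : ℝ) ≤ ρ := zero_le_one.trans hρ.le
  have hr1 : r < 1 := by nlinarith
  have hD := absConv_X_mul_derivative_autSeries hr.le h0 h
  have h1 := hD.hasSum_mul hρ.le hD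
  refine hasSum_lt (i := 2) (fun m => ?_) ?_ (hasSum_mul_coeff_autSeries_sq hr.le hr1) h1
  · simp only [coeff_X_mul_derivative]
    have : (m : ℝ) ≤ m * m := by exact_mod_cast Nat.le_mul_self m
    nlinarith [mul_self_nonneg (coeff m (autSeries r))]
  · simp only [coeff_X_mul_derivative]
    rw [coeff_autSeries_succ]
    have : 0 < (1 - r ^ 2) * r := mul_pos (by nlinarith) hr
    push_cast
    nlinarith [mul_pos this this]

end BeurlingSobolev

namespace BeurlingSobolev

/-! ### Uniform smallness of the coefficients -/

/-- Without error the solution with these initial values is C_k(c)w, where C_0 = 2 and C_1 = x. Each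
step multiplies the accumulated error by a bounded factor. -/
lemma abs_sub_chebyshev_mul_le {c M E w : ℝ} (hc : |c| ≤ M) (hE : 0 ≤ E) {v : ℕ → ℝ} {L : ℕ}
    (h0 : v 0 = 2 * w) (h1 : v 1 = c * w)
    (hv : ∀ k, k + 2 ≤ L → |v (k + 2) - c * v (k + 1) + v k| ≤ E) (k : ℕ) (hk : k ≤ L) :
    |v k - (Polynomial.Chebyshev.C ℝ k).eval c * w| ≤ E * (M + 2) ^ k := by
  have hM : 0 ≤ M := (abs_nonneg c).trans hc
  induction k using Nat.strong_induction_on with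
  | _ k ih =>
    match k with
    | 0 => simp [h0, hE]
    | 1 =>
      simp [h1]
      positivity
    | k + 2 =>
      have i1 := ih (k + 1) (by omega) (by omega)
      have i0 := ih k (by omega) (by omega)
      have hr : (Polynomial.Chebyshev.C ℝ ((k + 2 : ℕ) : ℤ)).eval c =
          c * (Polynomial.Chebyshev.C ℝ ((k + 1 : ℕ) : ℤ)).eval c -
            (Polynomial.Chebyshev.C ℝ (k : ℤ)).eval c := by
        push_cast
        rw [Polynomial.Chebyshev.C_add_two]
        simp
      rw [hr]
      set t1 := (Polynomial.Chebyshev.C ℝ ((k + 1 : ℕ) : ℤ)).eval c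
      set t0 := (Polynomial.Chebyshev.C ℝ (k : ℤ)).eval c
      have e : v (k + 2) - (c * t1 - t0) * w = (v (k + 2) - c * v (k + 1) + v k) +
          c * (v (k + 1) - t1 * w) - (v k - t0 * w) := by ring
      rw [e]
      have b1 : |c * (v (k + 1) - t1 * w)| ≤ M * (E * (M + 2) ^ (k + 1)) := by
        rw [abs_mul]; gcongr
      have b2 : E ≤ E * (M + 2) ^ k := le_mul_of_one_le_right hE (one_le_pow₀ (by linarith))
      have b3 := hv k hk
      have b4 : 0 ≤ E * (M + 2) ^ k * M := by positivity
      calc _ ≤ |v (k + 2) - c * v (k + 1) + v k| + |c * (v (k + 1) - t1 * w)| + |v k - t0 * w| :=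
            (abs_sub _ _).trans (by gcongr; exact abs_add_le _ _)
        _ ≤ E * (M + 2) ^ k + M * (E * (M + 2) ^ (k + 1)) + E * (M + 2) ^ k := by gcongr; linarith
        _ ≤ E * (M + 2) ^ (k + 2) := by
            have : E * (M + 2) ^ (k + 2) - (E * (M + 2) ^ k + M * (E * (M + 2) ^ (k + 1)) +
              E * (M + 2) ^ k) = 2 * (E * (M + 2) ^ k * M) + 2 * (E * (M + 2) ^ k) := by ring
            nlinarith

/-- C_2k = C_k² - 2, so both values cannot lie in (-1, 1). No bound on c is needed. -/
lemma one_le_abs_chebyshev_or (c : ℝ) (k : ℕ) :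
    1 ≤ |(Polynomial.Chebyshev.C ℝ k).eval c| ∨
      1 ≤ |(Polynomial.Chebyshev.C ℝ ((2 * k : ℕ) : ℤ)).eval c| := by
  have h : (Polynomial.Chebyshev.C ℝ ((2 * k : ℕ) : ℤ)).eval c =
      (Polynomial.Chebyshev.C ℝ k).eval c ^ 2 - 2 := by
    push_cast
    rw [Polynomial.Chebyshev.C_mul, Polynomial.Chebyshev.C_two]
    simp
  rw [h]
  by_contra! hcon
  have h1 := sq_lt_one_iff_abs_lt_one _ |>.2 hcon.1
  have h2 := abs_lt.1 hcon.2
  linarith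

lemma sum_comp_le_of_hasSum {f : ℕ → ℝ} (hf : ∀ m, 0 ≤ f m) {a : ℝ} (h : HasSum f a)
    (s : Finset ℕ) (g : ℕ → ℕ) (hg : Set.InjOn g s) : ∑ k ∈ s, f (g k) ≤ a := by
  rw [← Finset.sum_image (f := f) hg]
  exact sum_le_hasSum _ (fun m _ => hf m) h

/-- Add the recurrences centred at m + k + 1 and m - k - 1. Their middle coefficients depend on the
centre only through n/j; freezing it at n/m costs an amount bounded independently of m. -/
lemma abs_symm_recurrence_le {r : ℝ} (hr : 0 < r) (hr1 : r < 1) {m n k R : ℕ} (hk : k + 1 < m)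
    (hn : n ≤ R * m) (hx : ∀ j, |autCoeff r j n| ≤ 1) {u : ℕ → ℝ}
    (hu : ∀ j, u j = j * autCoeff r j n) :
    |(u (m + (k + 2)) + u (m - (k + 2))) - ((n * (1 - r ^ 2) / m - (1 + r ^ 2)) / r) *
      (u (m + (k + 1)) + u (m - (k + 1))) + (u (m + k) + u (m - k))| ≤ 2 * (R / r) * (k + 1) := by
  obtain ⟨l, rfl⟩ := Nat.exists_eq_add_of_lt hk
  have a1 := autCoeff_recurrence r l n
  have a2 := autCoeff_recurrence r (k + 1 + l + 1 + k) n
  rw [show k + 1 + l + 1 - (k + 2) = l by omega, show k + 1 + l + 1 - (k + 1) = l + 1 by omega,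
    show k + 1 + l + 1 - k = l + 2 by omega, show k + 1 + l + 1 + (k + 1) = k + 1 + l + 1 + k + 1 by omega,
    show k + 1 + l + 1 + (k + 2) = k + 1 + l + 1 + k + 2 by omega]
  simp only [hu]
  set xp := autCoeff r (k + 1 + l + 1 + k + 1) n
  set xm := autCoeff r (l + 1) n
  set m := k + 1 + l + 1 with hm
  have hm0 : (0 : ℝ) < m := by rw [hm]; positivity
  have hml : (m : ℝ) = k + 1 + l + 1 := by rw [hm]; push_cast; ring
  have key : ((m + k + 2 : ℕ) * autCoeff r (m + k + 2) n + l * autCoeff r l n) -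
      ((n * (1 - r ^ 2) / m - (1 + r ^ 2)) / r) * ((m + k + 1 : ℕ) * xp + (l + 1 : ℕ) * xm) +
      ((m + k : ℕ) * autCoeff r (m + k) n + (l + 2 : ℕ) * autCoeff r (l + 2) n) =
      (n / m) * ((1 - r ^ 2) / r) * (k + 1) * (xm - xp) := by
    push_cast at a1 a2 ⊢
    field_simp
    rw [show (l : ℝ) = m - k - 2 by rw [hml]; ring] at a1 ⊢
    linear_combination (m : ℝ) * (a1 + a2)
  rw [key, abs_mul, abs_of_nonneg (by have : 0 ≤ 1 - r ^ 2 := by nlinarith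
                                      positivity)]
  have hnm : (n / m : ℝ) ≤ R := by
    rw [div_le_iff₀ hm0]; exact_mod_cast hn
  have hx2 : |xm - xp| ≤ 2 := (abs_sub _ _).trans (by linarith [hx (l + 1), hx (m + k + 1)])
  have h3 : (1 - r ^ 2) / r ≤ 1 / r := by gcongr; nlinarith
  have h4 : 0 ≤ (1 - r ^ 2) / r := div_nonneg (by nlinarith) hr.le
  calc _ ≤ R * (1 / r) * (k + 1) * 2 := by gcongr
    _ = _ := by ring

/-- The coefficients `autCoeff r m n` tend to zero as `m → ∞`, uniformly in `n ≤ R m`. -/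
lemma exists_abs_autCoeff_le {r : ℝ} (hr : 0 < r) (hr1 : r < 1)
    (hsum : ∀ n, HasSum (fun m => autCoeff r m n ^ 2) 1) (R : ℕ) {ε : ℝ} (hε : 0 < ε) :
    ∃ N : ℕ, ∀ m ≥ N, ∀ n ≤ R * m, |autCoeff r m n| ≤ ε := by
  -- Each k ≤ L will contribute ε²/64 to four sums, each at most 1, so a counterexample forces L ≤
  -- 256/ε².
  obtain ⟨L, hL⟩ := exists_nat_gt (256 / ε ^ 2)
  have hx : ∀ j n, |autCoeff r j n| ≤ 1 := fun j n => by
    have := le_hasSum (hsum n) j fun _ _ => sq_nonneg _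
    exact (sq_le_one_iff_abs_le_one _).1 this
  set M : ℝ := (R + 2) / r
  set E : ℝ := 2 * (R / r) * (2 * L)
  have hE : 0 ≤ E := by positivity
  have hM : 0 ≤ M := by positivity
  obtain ⟨N, hN⟩ := exists_nat_gt (2 * (E * (M + 2) ^ (2 * L)) / ε)
  refine ⟨max N (2 * L + 1), fun m hm n hn => ?_⟩
  by_contra! hA
  have hmL : 2 * L + 1 ≤ m := (le_max_right _ _).trans hm
  have hmN : 2 * (E * (M + 2) ^ (2 * L)) ≤ m * ε := by
    rw [div_lt_iff₀ hε] at hN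
    refine hN.le.trans ?_
    gcongr
    exact (le_max_left _ _).trans hm
  have hm0 : (0 : ℝ) < m := by exact_mod_cast (by omega : 0 < m)
  set x : ℕ → ℝ := fun j => autCoeff r j n with hxdef
  set u : ℕ → ℝ := fun j => j * x j with hu
  set c : ℝ := (n * (1 - r ^ 2) / m - (1 + r ^ 2)) / r with hc
  set v : ℕ → ℝ := fun k => u (m + k) + u (m - k) with hv
  have hnm : (n / m : ℝ) ≤ R := by
    rw [div_le_iff₀ hm0]; exact_mod_cast hn
  have hcM : |c| ≤ M := by
    rw [hc, abs_div, abs_of_pos hr]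
    refine div_le_div_of_nonneg_right ?_ hr.le
    have h1 : n * (1 - r ^ 2) / m ≤ R := by
      refine le_trans ?_ hnm
      gcongr
      nlinarith [(Nat.cast_nonneg n : (0 : ℝ) ≤ n)]
    have h2 : 0 ≤ n * (1 - r ^ 2) / m := div_nonneg (mul_nonneg (by positivity) (by nlinarith)) hm0.le
    rw [abs_le]
    constructor <;> nlinarith
  have v0 : v 0 = 2 * u m := by simp [hv]; ring
  -- The recurrence centred at m itself is exact.
  have v1 : v 1 = c * u m := by
    obtain ⟨l, rfl⟩ : ∃ l, m = l + 1 := ⟨m - 1, by omega⟩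
    have a1 := autCoeff_recurrence r l n
    simp only [hv, hu, hc, hxdef, Nat.add_sub_cancel]
    push_cast at hm0 ⊢
    field_simp
    linear_combination a1
  have hvE : ∀ k, k + 2 ≤ 2 * L → |v (k + 2) - c * v (k + 1) + v k| ≤ E := fun k hk => by
    refine (abs_symm_recurrence_le hr hr1 (by omega) hn (fun j => hx j n) (fun j => rfl)).trans ?_
    have : (k + 1 : ℝ) ≤ 2 * L := by exact_mod_cast (by omega : k + 1 ≤ 2 * L)
    exact mul_le_mul_of_nonneg_left this (by positivity)
  have hcheb := abs_sub_chebyshev_mul_le hcM hE v0 v1 hvE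
  have hum : m * ε < |u m| := by
    simp only [hu, abs_mul, Nat.abs_cast]
    gcongr
  have hvx : ∀ k ≤ 2 * L, |v k| ≤ 2 * m * (|x (m + k)| + |x (m - k)|) := fun k hk => by
    simp only [hv, hu]
    refine (abs_add_le _ _).trans ?_
    rw [abs_mul, abs_mul, Nat.abs_cast, Nat.abs_cast, mul_add]
    have h1 : ((m + k : ℕ) : ℝ) ≤ 2 * m := by exact_mod_cast (by omega : m + k ≤ 2 * m)
    have h2 : ((m - k : ℕ) : ℝ) ≤ 2 * m := by exact_mod_cast (by omega : m - k ≤ 2 * m)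
    gcongr
  -- Here v_k is at least |u_m| minus an error that the choice of N keeps below mε/2, so the entries
  -- at m ± k cannot both be small.
  have hbig : ∀ k ≤ 2 * L, 1 ≤ |(Polynomial.Chebyshev.C ℝ k).eval c| →
      ε / 4 ≤ |x (m + k)| + |x (m - k)| := fun k hk h1 => by
    have b1 := hcheb k hk
    have b2 : E * (M + 2) ^ k ≤ E * (M + 2) ^ (2 * L) := by gcongr; linarith
    have b3 : |u m| ≤ |(Polynomial.Chebyshev.C ℝ k).eval c * u m| := by
      rw [abs_mul _ (u m)]; exact le_mul_of_one_le_left (abs_nonneg _) h1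
    have b4 := abs_sub_abs_le_abs_sub ((Polynomial.Chebyshev.C ℝ k).eval c * u m) (v k)
    rw [abs_sub_comm] at b4
    have b5 := hvx k hk
    have : 2 * m * (ε / 4) ≤ 2 * m * (|x (m + k)| + |x (m - k)|) := by linarith
    exact le_of_mul_le_mul_left this (by positivity)
  have hsq : ∀ k < L, ε ^ 2 / 64 ≤ x (m + (k + 1)) ^ 2 + x (m - (k + 1)) ^ 2 +
      x (m + 2 * (k + 1)) ^ 2 + x (m - 2 * (k + 1)) ^ 2 := fun k hk => by
    have aux : ∀ y z : ℝ, ε / 4 ≤ |y| + |z| → ε ^ 2 / 64 ≤ y ^ 2 + z ^ 2 := fun y z h => by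
      rw [← sq_abs y, ← sq_abs z]
      have := pow_le_pow_left₀ (by positivity) h 2
      nlinarith [sq_nonneg (|y| - |z|), sq_nonneg ε]
    rcases one_le_abs_chebyshev_or c (k + 1) with h | h
    · have := aux _ _ (hbig (k + 1) (by omega) h)
      nlinarith [sq_nonneg (x (m + 2 * (k + 1))), sq_nonneg (x (m - 2 * (k + 1)))]
    · have := aux _ _ (hbig (2 * (k + 1)) (by omega) h)
      nlinarith [sq_nonneg (x (m + (k + 1))), sq_nonneg (x (m - (k + 1)))]
  have htot := Finset.sum_le_sum fun k hk => hsq k (Finset.mem_range.1 hk)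
  simp only [Finset.sum_add_distrib, Finset.sum_const, Finset.card_range, nsmul_eq_mul] at htot
  have hb := fun g hg => sum_comp_le_of_hasSum (fun j => sq_nonneg (x j)) (hsum n) (Finset.range L) g hg
  have s1 := hb (fun k => m + (k + 1)) fun a _ b _ h => by simp at h; omega
  have s2 := hb (fun k => m - (k + 1)) fun a ha b hb' h => by
    simp at h ha hb'; omega
  have s3 := hb (fun k => m + 2 * (k + 1)) fun a _ b _ h => by simp at h; omega
  have s4 := hb (fun k => m - 2 * (k + 1)) fun a ha b hb' h => by
    simp at h ha hb'; omega
  rw [div_lt_iff₀ (by positivity)] at hL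
  linarith

end BeurlingSobolev

namespace BeurlingSobolev

open PowerSeries Filter

/-! ### Concentration of the squared coefficients -/

/-- A Cauchy-type estimate at radius ρ: |A(m, n)|ρ^m ≤ ‖T‖^n. Taking ρ^M > ‖T‖² absorbs the right
side once m ≥ Mn. -/
lemma exists_autCoeff_sq_le {r ρ : ℝ} (hr : 0 ≤ r) (hρ : 1 < ρ) (h : r * ρ < 1) :
    ∃ M : ℕ, 2 ≤ M ∧ ∀ m n, M * n ≤ m → autCoeff r m n ^ 2 ≤ ρ⁻¹ ^ m := by
  have h0 : (0 : ℝ) < ρ := zero_lt_one.trans hρ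
  have hT := absConv_autSeries hr h0.le h
  obtain ⟨M, hM⟩ := pow_unbounded_of_one_lt (absNorm ρ (autSeries r) ^ 2) hρ
  refine ⟨M + 2, by omega, fun m n hmn => ?_⟩
  have h1 := ((hT.pow h0.le n).abs_coeff_le h0.le m).trans (absNorm_pow_le h0.le hT n)
  have h2 := pow_le_pow_left₀ (by positivity) h1 2
  rw [mul_pow, sq_abs, pow_right_comm (absNorm _ _)] at h2
  have h3 : (absNorm ρ (autSeries r) ^ 2) ^ n ≤ ρ ^ m :=
    calc _ ≤ (ρ ^ M) ^ n := by gcongr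
      _ = ρ ^ (M * n) := (pow_mul _ _ _).symm
      _ ≤ ρ ^ m := pow_le_pow_right₀ hρ.le (by nlinarith)
  rw [inv_pow, ← one_div, le_div_iff₀ (by positivity)]
  have h4 : autCoeff r m n ^ 2 * ρ ^ m * ρ ^ m ≤ 1 * ρ ^ m := by
    rw [one_mul]
    calc _ = autCoeff r m n ^ 2 * (ρ ^ m) ^ 2 := by ring
      _ ≤ _ := h2.trans h3
  exact le_of_mul_le_mul_right h4 (by positivity)

lemma autCoeff_zero_left (r : ℝ) (n : ℕ) : autCoeff r 0 n = r ^ n := by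
  simp [autCoeff, autSeries]

/-- The symmetry turns the upper tail bound into one for small m. It says nothing at m = 0, where
the entry is r^n. -/
lemma sum_low_autCoeff_sq_le {r ρ : ℝ} (hr : 0 ≤ r) (hρ : 1 < ρ) (h : r * ρ < 1) {M : ℕ}
    (hM : ∀ m n, M * n ≤ m → autCoeff r m n ^ 2 ≤ ρ⁻¹ ^ m) {n : ℕ} (hn : 1 ≤ n) :
    ∑ m ∈ (Finset.range n).filter (fun m => ¬ n ≤ M * m), autCoeff r m n ^ 2 ≤
      (n : ℝ) ^ 3 * ρ⁻¹ ^ n := by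
  have h0 : (0 : ℝ) < ρ := zero_lt_one.trans hρ
  have hn1 : (1 : ℝ) ≤ n := by exact_mod_cast hn
  have hterm : ∀ m ∈ (Finset.range n).filter (fun m => ¬ n ≤ M * m),
      autCoeff r m n ^ 2 ≤ (n : ℝ) ^ 2 * ρ⁻¹ ^ n := fun m hm => by
    rw [Finset.mem_filter] at hm
    rcases Nat.eq_zero_or_pos m with rfl | hm0
    · rw [autCoeff_zero_left]
      have hrρ : r ≤ ρ⁻¹ := by rw [← one_div, le_div_iff₀ h0]; exact h.le
      have hr1 : r ≤ 1 := by nlinarith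
      calc (r ^ n) ^ 2 ≤ r ^ n := pow_le_of_le_one (by positivity) (pow_le_one₀ hr hr1) two_ne_zero
        _ ≤ 1 * ρ⁻¹ ^ n := by rw [one_mul]; gcongr
        _ ≤ _ := by gcongr; exact one_le_pow₀ hn1
    · have h1 := hM n m (by omega)
      have h2 := congrArg (· ^ 2) (mul_abs_autCoeff_swap r m n)
      simp only [mul_pow, sq_abs] at h2
      have hm1 : (1 : ℝ) ≤ (m : ℝ) ^ 2 := one_le_pow₀ (by exact_mod_cast hm0)
      calc _ ≤ (m : ℝ) ^ 2 * autCoeff r m n ^ 2 := le_mul_of_one_le_left (sq_nonneg _) hm1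
        _ = (n : ℝ) ^ 2 * autCoeff r n m ^ 2 := h2
        _ ≤ _ := by gcongr
  refine (Finset.sum_le_card_nsmul _ _ _ hterm).trans ?_
  rw [nsmul_eq_mul]
  have : ((((Finset.range n).filter (fun m => ¬ n ≤ M * m)).card : ℕ) : ℝ) ≤ n := by
    exact_mod_cast (Finset.card_filter_le _ _).trans (by simp)
  calc _ ≤ (n : ℝ) * ((n : ℝ) ^ 2 * ρ⁻¹ ^ n) := by gcongr
    _ = _ := by ring

/-- Lower bounds for a sequence of weights on both sides of its mean `n`, from its variance and a
tail estimate. -/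
lemma le_sum_of_moments {w : ℕ → ℝ} (hw : ∀ m, 0 ≤ w m) {n M : ℕ} {s δ : ℝ} (hM : 1 ≤ M)
    (hn : 1 ≤ n) (h0 : HasSum w 1) (h1 : HasSum (fun m : ℕ => m * w m) n)
    (h2 : HasSum (fun m : ℕ => (m : ℝ) ^ 2 * w m) (s * (n : ℝ) ^ 2))
    (htail : ∑' m : ℕ, ((m + M * n : ℕ) : ℝ) ^ 2 * w (m + M * n) ≤ δ)
    (hδ : δ ≤ (s - 1) / 2) (hn' : 4 * M * δ ≤ (s - 1) * n) :
    (s - 1) / (8 * M ^ 2) ≤ ∑ m ∈ Finset.Ico n (M * n), w m ∧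
      (s - 1) / (4 * M) ≤ ∑ m ∈ Finset.range n, w m := by
  have hn1 : (1 : ℝ) ≤ n := by exact_mod_cast hn
  have hM1 : (1 : ℝ) ≤ M := by exact_mod_cast hM
  set K := M * n with hK
  have hnK : n ≤ K := Nat.le_mul_of_pos_left n hM
  have g1 : HasSum (fun m : ℕ => ((m : ℝ) - n) * w m) 0 := by
    have := h1.sub (h0.mul_left (n : ℝ))
    rw [mul_one, sub_self] at this
    simpa only [sub_mul] using this
  have g2 : HasSum (fun m : ℕ => ((m : ℝ) - n) ^ 2 * w m) ((s - 1) * (n : ℝ) ^ 2) := by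
    have := (h2.sub (h1.mul_left (2 * n : ℝ))).add (h0.mul_left ((n : ℝ) ^ 2))
    rw [show s * (n : ℝ) ^ 2 - 2 * n * n + (n : ℝ) ^ 2 * 1 = (s - 1) * (n : ℝ) ^ 2 by ring] at this
    refine Eq.mpr (congrArg (fun F : ℕ → ℝ => HasSum F _) (funext fun m => ?_)) this
    ring
  have e1 := g1.summable.sum_add_tsum_nat_add K
  have e2 := g2.summable.sum_add_tsum_nat_add K
  rw [g1.tsum_eq] at e1
  rw [g2.tsum_eq] at e2
  have hcast : ∀ m : ℕ, (n : ℝ) + 0 ≤ ((m + K : ℕ) : ℝ) := fun m => by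
    rw [add_zero]; exact_mod_cast (by omega : n ≤ m + K)
  have sT := (summable_nat_add_iff K).2 h2.summable
  have s1 := (summable_nat_add_iff K).2 g1.summable
  have s2 := (summable_nat_add_iff K).2 g2.summable
  have t2 : ∑' m : ℕ, (((m + K : ℕ) : ℝ) - n) ^ 2 * w (m + K) ≤ δ := by
    refine le_trans (Summable.tsum_le_tsum (fun m => ?_) s2 sT) htail
    have := hcast m
    gcongr
    · exact hw _
    · linarith
    · linarith
  have t1 : ∑' m : ℕ, (((m + K : ℕ) : ℝ) - n) * w (m + K) ≤ δ := by
    refine le_trans (Summable.tsum_le_tsum (fun m => ?_) s1 sT) htail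
    have := hcast m
    exact mul_le_mul_of_nonneg_right (by nlinarith) (hw _)
  have t1' : 0 ≤ ∑' m : ℕ, (((m + K : ℕ) : ℝ) - n) * w (m + K) :=
    tsum_nonneg fun m => mul_nonneg (by have := hcast m; linarith) (hw _)
  rw [← Finset.sum_range_add_sum_Ico _ hnK] at e1 e2
  set P := ∑ m ∈ Finset.Ico n K, ((m : ℝ) - n) * w m
  set Q := ∑ m ∈ Finset.range n, ((n : ℝ) - m) * w m with hQ
  have hQ' : ∑ m ∈ Finset.range n, ((m : ℝ) - n) * w m = -Q := by
    rw [hQ, ← Finset.sum_neg_distrib]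
    exact Finset.sum_congr rfl fun m _ => by ring
  rw [hQ'] at e1
  have hKr : (K : ℝ) = M * n := by rw [hK]; push_cast; ring
  have bP : ∑ m ∈ Finset.Ico n K, ((m : ℝ) - n) ^ 2 * w m ≤ K * P := by
    rw [Finset.mul_sum]
    refine Finset.sum_le_sum fun m hm => ?_
    have a1 : (n : ℝ) ≤ m := by exact_mod_cast (Finset.mem_Ico.1 hm).1
    have a2 : (m : ℝ) ≤ K := by exact_mod_cast (Finset.mem_Ico.1 hm).2.le
    rw [← mul_assoc, sq]
    exact mul_le_mul_of_nonneg_right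
      (mul_le_mul_of_nonneg_right (by linarith) (by linarith)) (hw m)
  have bQ : ∑ m ∈ Finset.range n, ((m : ℝ) - n) ^ 2 * w m ≤ K * Q := by
    rw [Finset.mul_sum]
    refine Finset.sum_le_sum fun m hm => ?_
    have a1 : (m : ℝ) ≤ n := by exact_mod_cast (Finset.mem_range.1 hm).le
    have a2 : (n : ℝ) ≤ K := by exact_mod_cast hnK
    have a3 : (0 : ℝ) ≤ m := Nat.cast_nonneg m
    rw [← mul_assoc, show ((m : ℝ) - n) ^ 2 = (n - m) * (n - m) by ring]
    exact mul_le_mul_of_nonneg_right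
      (mul_le_mul_of_nonneg_right (by linarith) (by linarith)) (hw m)
  have cP : P ≤ K * ∑ m ∈ Finset.Ico n K, w m := by
    rw [Finset.mul_sum]
    refine Finset.sum_le_sum fun m hm => mul_le_mul_of_nonneg_right ?_ (hw m)
    have a2 : (m : ℝ) ≤ K := by exact_mod_cast (Finset.mem_Ico.1 hm).2.le
    linarith
  have cQ : Q ≤ n * ∑ m ∈ Finset.range n, w m := by
    rw [Finset.mul_sum]
    refine Finset.sum_le_sum fun m hm => mul_le_mul_of_nonneg_right ?_ (hw m)
    have a3 : (0 : ℝ) ≤ m := Nat.cast_nonneg m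
    linarith
  -- The deviations are at most K = Mn below K, so the variance is at most K(P + Q) plus the tail.
  -- As the mean is n, P and Q differ by at most δ, and neither can be small.
  have hPQ : (s - 1) * n / 2 ≤ M * (P + Q) := by
    have hA : (s - 1) * (n : ℝ) ^ 2 - (s - 1) / 2 ≤ K * (P + Q) := by linarith
    have hs : 0 ≤ s - 1 := by
      have : (0 : ℝ) ≤ ∑' m : ℕ, ((m + M * n : ℕ) : ℝ) ^ 2 * w (m + M * n) :=
        tsum_nonneg fun m => mul_nonneg (sq_nonneg _) (hw _)
      linarith
    rw [hKr] at hA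
    refine le_of_mul_le_mul_right ?_ (zero_lt_one.trans_le hn1)
    nlinarith [mul_nonneg hs (by nlinarith : (0 : ℝ) ≤ (n : ℝ) ^ 2 - 1)]
  constructor
  · rw [div_le_iff₀ (by positivity)]
    refine le_of_mul_le_mul_right ?_ (zero_lt_one.trans_le hn1)
    rw [hKr] at cP
    have : M * (P + Q) ≤ M * (2 * P + δ) :=
      mul_le_mul_of_nonneg_left (by linarith) (by positivity)
    nlinarith
  · rw [div_le_iff₀ (by positivity)]
    refine le_of_mul_le_mul_right ?_ (zero_lt_one.trans_le hn1)
    have : M * (P + Q) ≤ M * (2 * Q) :=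
      mul_le_mul_of_nonneg_left (by linarith) (by positivity)
    nlinarith

lemma exists_le_sum_autCoeff_sq {r ρ : ℝ} (hr : 0 < r) (hρ : 1 < ρ) (h : r * ρ < 1) :
    ∃ M : ℕ, 1 ≤ M ∧ ∃ c : ℝ, 0 < c ∧ ∃ N : ℕ, ∀ n ≥ N,
      c ≤ ∑ m ∈ Finset.Ico n (M * n), autCoeff r m n ^ 2 ∧
      c ≤ ∑ m ∈ (Finset.range n).filter (fun m => n ≤ M * m), autCoeff r m n ^ 2 := by
  have h0 : (0 : ℝ) < ρ := zero_lt_one.trans hρ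
  have hρi : ρ⁻¹ < 1 := inv_lt_one_of_one_lt₀ hρ
  have hρn : ‖ρ⁻¹‖ < 1 := by rwa [Real.norm_of_nonneg (by positivity)]
  obtain ⟨M, hM2, hM⟩ := exists_autCoeff_sq_le hr.le hρ h
  have hM0 : (0 : ℝ) < M := by exact_mod_cast (by omega : 0 < M)
  have hM1 : (1 : ℝ) ≤ M := by exact_mod_cast (by omega : 1 ≤ M)
  have hs := one_lt_secondMoment hr hρ h
  set s := secondMoment r
  have hs1 : 0 < s - 1 := by linarith
  refine ⟨M, by omega, (s - 1) / (8 * M ^ 2), by positivity, ?_⟩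
  set δ : ℝ := (s - 1) / (4 * M) with hδ
  have hδ0 : 0 < δ := by positivity
  have hsumm := summable_pow_mul_geometric_of_norm_lt_one 2 hρn
  have ev1 : ∀ᶠ n : ℕ in atTop, ∑' k : ℕ, ((k + n : ℕ) : ℝ) ^ 2 * ρ⁻¹ ^ (k + n) < δ :=
    (tendsto_sum_nat_add fun m : ℕ => (m : ℝ) ^ 2 * ρ⁻¹ ^ m).eventually (gt_mem_nhds hδ0)
  have ev2 : ∀ᶠ n : ℕ in atTop, (n : ℝ) ^ 3 * ρ⁻¹ ^ n < (s - 1) / (8 * M) :=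
    (tendsto_pow_const_mul_const_pow_of_abs_lt_one 3 hρn).eventually
      (gt_mem_nhds (by positivity))
  obtain ⟨N1, hN1⟩ := eventually_atTop.1 ev1
  obtain ⟨N2, hN2⟩ := eventually_atTop.1 ev2
  refine ⟨max 1 (max N1 N2), fun n hn => ?_⟩
  have hn1 : 1 ≤ n := (le_max_left _ _).trans hn
  have hnN1 : N1 ≤ n := ((le_max_left _ _).trans (le_max_right _ _)).trans hn
  have hnN2 : N2 ≤ n := ((le_max_right _ _).trans (le_max_right _ _)).trans hn
  have hn1' : (1 : ℝ) ≤ n := by exact_mod_cast hn1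
  have htail : ∑' m : ℕ, ((m + M * n : ℕ) : ℝ) ^ 2 * autCoeff r (m + M * n) n ^ 2 ≤ δ := by
    refine le_trans (Summable.tsum_le_tsum (fun m => ?_)
      ((summable_nat_add_iff (M * n)).2 (hasSum_sq_mul_autCoeff_sq hr.le hρ h n).summable)
      ((summable_nat_add_iff (M * n)).2 hsumm)) (hN1 (M * n) (by nlinarith)).le
    gcongr
    exact hM _ _ (by omega)
  obtain ⟨c1, c2⟩ := le_sum_of_moments (fun m => sq_nonneg (autCoeff r m n)) (by omega : 1 ≤ M) hn1
    (hasSum_autCoeff_sq hr.le hρ.le h n) (hasSum_mul_autCoeff_sq hr.le hρ h n)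
    (hasSum_sq_mul_autCoeff_sq hr.le hρ h n) htail
    (by rw [hδ]; exact div_le_div_of_nonneg_left hs1.le two_pos (by linarith))
    (by rw [hδ]; field_simp; exact le_mul_of_one_le_right hs1.le hn1')
  refine ⟨c1, ?_⟩
  have c3 := sum_low_autCoeff_sq_le hr.le hρ h hM hn1
  have c4 := hN2 n hnN2
  rw [← Finset.sum_filter_add_sum_filter_not _ (fun m => n ≤ M * m)] at c2
  have c5 : (s - 1) / (4 * M) = (s - 1) / (8 * M) + (s - 1) / (8 * M) := by field_simp; norm_num
  have c6 : (s - 1) / (8 * M ^ 2) ≤ (s - 1) / (8 * M) :=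
    div_le_div_of_nonneg_left hs1.le (by positivity) (by nlinarith)
  linarith

/-- There are finite index sets on which all row sums and all column sums of
`|autCoeff r m n| ^ q` are large, if `q < 2`. -/
lemma exists_finset_le_sum_rpow {r : ℝ} (hr : 0 < r) (hr1 : r < 1) {q : ℝ} (hq : 0 < q)
    (hq2 : q < 2) (K : ℝ) : ∃ I : Finset ℕ, I.Nonempty ∧
      (∀ n ∈ I, K ≤ ∑ m ∈ I, |autCoeff r m n| ^ q) ∧
      ∀ m ∈ I, K ≤ ∑ n ∈ I, |autCoeff r m n| ^ q := by
  obtain ⟨ρ, hρ, hρr⟩ := exists_between ((one_lt_inv₀ hr).2 hr1)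
  have hrρ : r * ρ < 1 := by
    calc r * ρ < r * r⁻¹ := by gcongr
      _ = 1 := mul_inv_cancel₀ hr.ne'
  obtain ⟨M, hM, c, hc, N, hN⟩ := exists_le_sum_autCoeff_sq hr hρ hrρ
  have hM0 : (0 : ℝ) < M := by exact_mod_cast hM
  have hM1 : (1 : ℝ) ≤ M := by exact_mod_cast hM
  -- The extra factor pays for passing from columns to rows, where the symmetry loses at most a
  -- ratio M² of indices.
  set K' : ℝ := max K 1 * ((M : ℝ) ^ 2) ^ q
  have hK' : 0 < K' := by positivity
  obtain ⟨ε, hε, hεc⟩ : ∃ ε : ℝ, 0 < ε ∧ K' * ε ^ (2 - q) = c := by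
    refine ⟨(c / K') ^ (2 - q)⁻¹, by positivity, ?_⟩
    rw [← Real.rpow_mul (by positivity), inv_mul_cancel₀ (by linarith), Real.rpow_one]
    field_simp
  obtain ⟨N', hN'⟩ := exists_abs_autCoeff_le hr hr1
    (hasSum_autCoeff_sq hr.le hρ.le hrρ) (M ^ 2) hε
  set L := max 1 (max N N')
  have hL1 : 1 ≤ L := le_max_left _ _
  have hLN : N ≤ L := (le_max_left _ _).trans (le_max_right _ _)
  have hLN' : N' ≤ L := (le_max_right _ _).trans (le_max_right _ _)
  set I := Finset.Icc L (M ^ 2 * L)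
  have hratio : ∀ m ∈ I, ∀ n ∈ I, n ≤ M ^ 2 * m := fun m hm n hn =>
    (Finset.mem_Icc.1 hn).2.trans (Nat.mul_le_mul_left _ (Finset.mem_Icc.1 hm).1)
  have hsmall : ∀ m ∈ I, ∀ n ∈ I, |autCoeff r m n| ≤ ε := fun m hm n hn =>
    hN' m (hLN'.trans (Finset.mem_Icc.1 hm).1) n (hratio m hm n hn)
  have hmass : ∀ n ∈ I, c ≤ ∑ m ∈ I, autCoeff r m n ^ 2 := fun n hn => by
    obtain ⟨hn1, hn2⟩ := Finset.mem_Icc.1 hn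
    obtain ⟨m1, m2⟩ := hN n (hLN.trans hn1)
    -- In the lower part of the block the mass above n stays inside it; in the upper part the mass
    -- below n does.
    rcases le_or_gt n (M * L) with hnL | hnL
    · refine m1.trans (Finset.sum_le_sum_of_subset_of_nonneg (fun m hm => ?_)
        fun _ _ _ => sq_nonneg _)
      rw [Finset.mem_Ico] at hm
      refine Finset.mem_Icc.2 ⟨hn1.trans hm.1, hm.2.le.trans ?_⟩
      rw [sq, mul_assoc]
      exact Nat.mul_le_mul_left _ hnL
    · refine m2.trans (Finset.sum_le_sum_of_subset_of_nonneg (fun m hm => ?_)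
        fun _ _ _ => sq_nonneg _)
      rw [Finset.mem_filter, Finset.mem_range] at hm
      exact Finset.mem_Icc.2
        ⟨(Nat.lt_of_mul_lt_mul_left (hnL.trans_le hm.2)).le, hm.1.le.trans hn2⟩
  have hcol : ∀ n ∈ I, K' ≤ ∑ m ∈ I, |autCoeff r m n| ^ q := fun n hn => by
    have hεq : 0 < ε ^ (2 - q) := by positivity
    refine le_of_mul_le_mul_right ?_ hεq
    rw [hεc, Finset.sum_mul]
    refine (hmass n hn).trans (Finset.sum_le_sum fun m hm => ?_)
    rw [← sq_abs, ← Real.rpow_natCast, show ((2 : ℕ) : ℝ) = q + (2 - q) by push_cast; ring,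
      Real.rpow_add_of_nonneg (abs_nonneg _) hq.le (by linarith)]
    gcongr
    exact hsmall m hm n hn
  have hKK' : K ≤ K' := by
    refine (le_max_left K 1).trans (le_mul_of_one_le_right (by positivity) ?_)
    exact Real.one_le_rpow (one_le_pow₀ hM1) hq.le
  refine ⟨I, ⟨L, Finset.mem_Icc.2 ⟨le_rfl, Nat.le_mul_of_pos_left L (by positivity)⟩⟩,
    fun n hn => hKK'.trans (hcol n hn), fun m hm => ?_⟩
  have hMq : 0 < ((M : ℝ) ^ 2) ^ q := by positivity
  refine (le_max_left K 1).trans (le_of_mul_le_mul_right ?_ hMq)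
  refine (hcol m hm).trans ?_
  rw [Finset.sum_mul]
  refine Finset.sum_le_sum fun n hn => ?_
  rw [← Real.mul_rpow (abs_nonneg _) (by positivity)]
  gcongr
  have hn0 : (0 : ℝ) < n := by
    exact_mod_cast hL1.trans (Finset.mem_Icc.1 hn).1
  have hmn : (m : ℝ) ≤ M ^ 2 * n := by exact_mod_cast hratio n hn m hm
  refine le_of_mul_le_mul_left ?_ hn0
  rw [mul_abs_autCoeff_swap]
  calc m * |autCoeff r m n| ≤ (M ^ 2 * n) * |autCoeff r m n| := by gcongr
    _ = _ := by ring

end BeurlingSobolev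

namespace BeurlingSobolev

open PowerSeries Filter Topology
open scoped ENNReal NNReal

/-! ### Composition with disk automorphisms in terms of coefficients -/

lemma hasSum_coeff_mul {f g : PowerSeries ℝ} (hf : AbsConv 1 f) (hg : AbsConv 1 g) {z F G : ℂ}
    (hz : ‖z‖ ≤ 1) (hF : HasSum (fun m => ((coeff m f : ℝ) : ℂ) * z ^ m) F)
    (hG : HasSum (fun m => ((coeff m g : ℝ) : ℂ) * z ^ m) G) :
    HasSum (fun m => ((coeff m (f * g) : ℝ) : ℂ) * z ^ m) (F * G) := by
  have hn : ∀ {f : PowerSeries ℝ}, AbsConv 1 f →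
      Summable fun m => ‖((coeff m f : ℝ) : ℂ) * z ^ m‖ := fun {f} hf => by
    refine Summable.of_nonneg_of_le (fun _ => norm_nonneg _) (fun m => ?_) (hf.summable_abs le_rfl)
    rw [norm_mul, norm_pow, Complex.norm_real, Real.norm_eq_abs]
    exact mul_le_of_le_one_right (abs_nonneg _) (pow_le_one₀ (norm_nonneg _) hz)
  rw [← hF.tsum_eq, ← hG.tsum_eq,
    tsum_mul_tsum_eq_tsum_sum_antidiagonal_of_summable_norm (hn hf) (hn hg)]
  have e : (fun m => ((coeff m (f * g) : ℝ) : ℂ) * z ^ m) = fun m =>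
      ∑ kl ∈ Finset.HasAntidiagonal.antidiagonal m, ((coeff kl.1 f : ℝ) : ℂ) * z ^ kl.1 *
        (((coeff kl.2 g : ℝ) : ℂ) * z ^ kl.2) := by
    funext m
    rw [coeff_mul, Complex.ofReal_sum, Finset.sum_mul]
    refine Finset.sum_congr rfl fun p hp => ?_
    rw [← Finset.HasAntidiagonal.mem_antidiagonal.1 hp, Complex.ofReal_mul, pow_add]
    ring
  rw [e]
  exact (summable_norm_sum_mul_antidiagonal_of_summable_norm (hn hf) (hn hg)).of_norm.hasSum

lemma one_add_ofReal_mul_ne_zero {r : ℝ} (hr : 0 ≤ r) (hr1 : r < 1) {z : ℂ} (hz : ‖z‖ < 1) :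
    1 + (r : ℂ) * z ≠ 0 := fun h => by
  have h1 : ‖(r : ℂ) * z‖ = 1 := by
    rw [eq_neg_of_add_eq_zero_right h, norm_neg, norm_one]
  rw [norm_mul, Complex.norm_real, Real.norm_of_nonneg hr] at h1
  nlinarith [norm_nonneg z]

lemma hasSum_coeff_autSeries {r : ℝ} (hr : 0 ≤ r) (hr1 : r < 1) {z : ℂ} (hz : ‖z‖ < 1) :
    HasSum (fun m => ((coeff m (autSeries r) : ℝ) : ℂ) * z ^ m) ((r + z) / (1 + r * z)) := by
  have hne := one_add_ofReal_mul_ne_zero hr hr1 hz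
  rw [← hasSum_nat_add_iff' 1]
  have h1 := (hasSum_geometric_of_norm_lt_one (ξ := -(r : ℂ) * z) (by
    rw [norm_mul, norm_neg, Complex.norm_real, Real.norm_of_nonneg hr]
    nlinarith [norm_nonneg z])).mul_left ((1 - r ^ 2) * z)
  have hval : (1 - (r : ℂ) ^ 2) * z * (1 - -(r : ℂ) * z)⁻¹ = (r + z) / (1 + r * z) -
      ∑ i ∈ Finset.range 1, ((coeff i (autSeries r) : ℝ) : ℂ) * z ^ i := by
    rw [show (1 : ℂ) - -(r : ℂ) * z = 1 + r * z by ring]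
    simp only [Finset.sum_range_one, pow_zero, mul_one]
    have : coeff 0 (autSeries r) = r := by simp [autSeries]
    rw [this]
    field_simp
    ring
  rw [hval] at h1
  refine Eq.mpr (congrArg (fun F : ℕ → ℂ => HasSum F _) (funext fun m => ?_)) h1
  rw [coeff_autSeries_succ]
  push_cast
  rw [mul_pow]
  ring

lemma hasSum_autCoeff_mul_pow {r : ℝ} (hr : 0 ≤ r) (hr1 : r < 1) {z : ℂ} (hz : ‖z‖ < 1) (n : ℕ) :
    HasSum (fun m => (autCoeff r m n : ℂ) * z ^ m) (((r + z) / (1 + r * z)) ^ n) := by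
  have hT : AbsConv 1 (autSeries r) := absConv_autSeries hr zero_le_one (by rwa [mul_one])
  induction n with
  | zero =>
    convert hasSum_single (f := fun m => (autCoeff r m 0 : ℂ) * z ^ m) 0 fun m hm => ?_ using 1
    · simp [autCoeff]
    · simp [autCoeff, coeff_one, hm]
  | succ n ih =>
    have := hasSum_coeff_mul (hT.pow zero_le_one n) hT hz.le ih (hasSum_coeff_autSeries hr hr1 hz)
    rwa [← pow_succ, ← pow_succ] at this

lemma taylorCoeff_eq_of_hasSum {f : ℂ → ℂ} {c : ℕ → ℂ}
    (h : ∀ z : ℂ, ‖z‖ < 1 → HasSum (fun m => c m * z ^ m) (f z)) (m : ℕ) :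
    taylorCoeff f m = c m := by
  have h1 : HasFPowerSeriesAt f (FormalMultilinearSeries.ofScalars ℂ c) 0 := by
    rw [hasFPowerSeriesAt_iff]
    filter_upwards [Metric.ball_mem_nhds (0 : ℂ) one_pos] with z hz
    simpa [FormalMultilinearSeries.coeff_ofScalars, mul_comm] using
      h z (by simpa using hz)
  have h2 := (h1.analyticAt.hasFPowerSeriesAt).eq_formalMultilinearSeries h1
  have h3 := congrArg (fun p : FormalMultilinearSeries ℂ ℂ ℂ => p.coeff m) h2
  simpa [FormalMultilinearSeries.coeff_ofScalars, taylorCoeff] using h3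

/-- The polynomial `∑ dₙ (c w)ⁿ`, summed over `n ∈ I`. -/
noncomputable def rotatedPoly (c : ℂ) (I : Finset ℕ) (d : ℕ → ℝ) (w : ℂ) : ℂ :=
  ∑ n ∈ I, (d n : ℂ) * (c * w) ^ n

lemma taylorCoeff_rotatedPoly (c : ℂ) (I : Finset ℕ) (d : ℕ → ℝ) (m : ℕ) :
    taylorCoeff (rotatedPoly c I d) m = if m ∈ I then (d m : ℂ) * c ^ m else 0 := by
  refine taylorCoeff_eq_of_hasSum (c := fun m => if m ∈ I then (d m : ℂ) * c ^ m else 0)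
    (fun z _ => ?_) m
  have : rotatedPoly c I d z = ∑ m ∈ I, (if m ∈ I then (d m : ℂ) * c ^ m else 0) * z ^ m :=
    Finset.sum_congr rfl fun m hm => by rw [if_pos hm, mul_pow, mul_assoc]
  rw [this]
  exact hasSum_sum_of_ne_finset_zero fun m hm => by rw [if_neg hm, zero_mul]

lemma norm_taylorCoeff_rotatedPoly {c : ℂ} (hc : ‖c‖ = 1) (I : Finset ℕ) (d : ℕ → ℝ) (m : ℕ) :
    ‖taylorCoeff (rotatedPoly c I d) m‖ = if m ∈ I then |d m| else 0 := by
  rw [taylorCoeff_rotatedPoly]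
  split_ifs <;> simp [hc]

/-- Since c T_a(z) = T_|a|(cz), the rotation only multiplies the m-th coefficient by c^m. -/
lemma norm_taylorCoeff_rotatedPoly_comp {a c : ℂ} (ha : ‖a‖ < 1) (hc : ‖c‖ = 1)
    (hac : c * a = ‖a‖) (I : Finset ℕ) (d : ℕ → ℝ) (m : ℕ) :
    ‖taylorCoeff (rotatedPoly c I d ∘ diskAut a) m‖ = |∑ n ∈ I, d n * autCoeff ‖a‖ m n| := by
  have hconj : (starRingEnd ℂ) a = ‖a‖ * c := by
    have h1 : (starRingEnd ℂ) c * c = 1 := by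
      rw [mul_comm, Complex.mul_conj, Complex.normSq_eq_norm_sq, hc]; simp
    have h2 : (starRingEnd ℂ) c * (starRingEnd ℂ) a = ‖a‖ := by
      rw [← map_mul, hac, Complex.conj_ofReal]
    linear_combination c * h2 - (starRingEnd ℂ) a * h1
  have key : taylorCoeff (rotatedPoly c I d ∘ diskAut a) m =
      ((∑ n ∈ I, d n * autCoeff ‖a‖ m n : ℝ) : ℂ) * c ^ m := by
    refine taylorCoeff_eq_of_hasSum
      (c := fun m => ((∑ n ∈ I, d n * autCoeff ‖a‖ m n : ℝ) : ℂ) * c ^ m) (fun z hz => ?_) m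
    have hcz : ‖c * z‖ < 1 := by rwa [norm_mul, hc, one_mul]
    have h1 := hasSum_sum fun n (_ : n ∈ I) =>
      (hasSum_autCoeff_mul_pow (norm_nonneg a) ha hcz n).mul_left (d n : ℂ)
    have e : (rotatedPoly c I d ∘ diskAut a) z =
        ∑ n ∈ I, (d n : ℂ) * (((‖a‖ : ℝ) + c * z) / (1 + (‖a‖ : ℝ) * (c * z))) ^ n := by
      refine Finset.sum_congr rfl fun n _ => ?_
      rw [diskAut, hconj, ← hac, mul_div_assoc', mul_add]
      ring
    rw [e]
    refine Eq.mpr (congrArg (fun F : ℕ → ℂ => HasSum F _) (funext fun m => ?_)) h1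
    push_cast
    rw [Finset.sum_mul, Finset.sum_mul]
    refine Finset.sum_congr rfl fun n _ => ?_
    rw [mul_pow]
    ring
  rw [key, norm_mul, norm_pow, hc, one_pow, mul_one, Complex.norm_real, Real.norm_eq_abs]

lemma exists_norm_one_mul_eq (a : ℂ) : ∃ c : ℂ, ‖c‖ = 1 ∧ c * a = ‖a‖ := by
  rcases eq_or_ne a 0 with rfl | ha
  · exact ⟨1, by simp⟩
  · have h : (‖a‖ : ℂ) ≠ 0 := by simpa using ha
    refine ⟨‖a‖ / a, ?_, by field_simp⟩
    rw [norm_div, Complex.norm_real, norm_norm, div_self (by simpa using ha)]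

lemma differentiableOn_rotatedPoly (c : ℂ) (I : Finset ℕ) (d : ℕ → ℝ) (s : Set ℂ) :
    DifferentiableOn ℂ (rotatedPoly c I d) s := by
  unfold rotatedPoly
  fun_prop

/-! ### Finite inequalities forced by boundedness -/

lemma enorm_rpow_mul_ofReal {p b : ℝ} (hp : 0 ≤ p) (z : ℂ) :
    ‖z‖ₑ ^ p * ENNReal.ofReal b = ENNReal.ofReal (‖z‖ ^ p * b) := by
  rw [← ofReal_norm, ENNReal.ofReal_rpow_of_nonneg (norm_nonneg z) hp,
    ENNReal.ofReal_mul (by positivity)]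

/-- A bounded composition operator on `h^p(β)`, `p < ∞`, gives an inequality for finite sums. -/
lemma InducesBoundedComp.exists_sum_le {p : ℝ≥0∞} (hp : 1 ≤ p) (hp' : p ≠ ∞) {β : ℕ → ℝ}
    (hβ : ∀ n, 0 < β n) {a : ℂ} (ha : ‖a‖ < 1) (h : InducesBoundedComp p β (diskAut a)) :
    ∃ C : ℝ, 0 ≤ C ∧ ∀ (I J : Finset ℕ) (d : ℕ → ℝ),
      ∑ m ∈ J, |∑ n ∈ I, d n * autCoeff ‖a‖ m n| ^ p.toReal * β m ≤
        C * ∑ n ∈ I, |d n| ^ p.toReal * β n := by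
  obtain ⟨C, hC⟩ := h
  obtain ⟨c, hc, hca⟩ := exists_norm_one_mul_eq a
  have hpr : 1 ≤ p.toReal := by
    have := ENNReal.toReal_mono hp' hp
    simpa using this
  set q := p.toReal with hq
  have hq0 : 0 < q := zero_lt_one.trans_le hpr
  refine ⟨(C : ℝ) ^ q, by positivity, fun I J d => ?_⟩
  set f := rotatedPoly c I d
  have hsum : ∑' n : ℕ, ‖taylorCoeff f n‖ₑ ^ q * ENNReal.ofReal (β n) =
      ENNReal.ofReal (∑ n ∈ I, |d n| ^ q * β n) := by
    simp only [enorm_rpow_mul_ofReal hq0.le, f, norm_taylorCoeff_rotatedPoly hc]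
    rw [tsum_eq_sum (s := I) fun n hn => by simp [hn, Real.zero_rpow hq0.ne'],
      ENNReal.ofReal_sum_of_nonneg fun n _ => mul_nonneg (by positivity) (hβ n).le]
    exact Finset.sum_congr rfl fun n hn => by rw [if_pos hn]
  have hnorm : bsNorm p β f = ENNReal.ofReal (∑ n ∈ I, |d n| ^ q * β n) ^ (1 / q) := by
    rw [bsNorm, if_neg hp', hsum]
  have hmem : MemBS p β f := by
    refine ⟨differentiableOn_rotatedPoly c I d _, ?_⟩
    rw [hnorm]
    exact ENNReal.rpow_lt_top_of_nonneg (by positivity) ENNReal.ofReal_ne_top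
  have hle := (hC f hmem).2
  rw [hnorm, bsNorm, if_neg hp', ← hq] at hle
  have hle2 := ENNReal.rpow_le_rpow hle hq0.le
  rw [ENNReal.mul_rpow_of_nonneg _ _ hq0.le, ← ENNReal.rpow_mul, ← ENNReal.rpow_mul,
    one_div_mul_cancel hq0.ne', ENNReal.rpow_one, ENNReal.rpow_one] at hle2
  have hle3 := (ENNReal.sum_le_tsum J).trans hle2
  simp only [enorm_rpow_mul_ofReal hq0.le, f, norm_taylorCoeff_rotatedPoly_comp ha hc hca] at hle3
  rw [← ENNReal.ofReal_sum_of_nonneg fun n _ => mul_nonneg (by positivity) (hβ n).le,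
    ← ENNReal.ofReal_coe_nnreal, ENNReal.ofReal_rpow_of_nonneg C.coe_nonneg hq0.le,
    ← ENNReal.ofReal_mul (by positivity)] at hle3
  exact (ENNReal.ofReal_le_ofReal_iff (mul_nonneg (by positivity)
    (Finset.sum_nonneg fun n _ => mul_nonneg (by positivity) (hβ n).le))).1 hle3

/-- A bounded composition operator on `h^∞(β)` gives an inequality for finite sums. -/
lemma InducesBoundedComp.exists_abs_sum_le {β : ℕ → ℝ} {a : ℂ} (ha : ‖a‖ < 1)
    (h : InducesBoundedComp ∞ β (diskAut a)) :
    ∃ C : ℝ, 0 ≤ C ∧ ∀ (I : Finset ℕ) (d : ℕ → ℝ), (∀ n ∈ I, |d n| * β n ≤ 1) →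
      ∀ m, |∑ n ∈ I, d n * autCoeff ‖a‖ m n| * β m ≤ C := by
  obtain ⟨C, hC⟩ := h
  obtain ⟨c, hc, hca⟩ := exists_norm_one_mul_eq a
  refine ⟨C, C.coe_nonneg, fun I d hd m => ?_⟩
  set f := rotatedPoly c I d
  have e : ∀ (z : ℂ) (b : ℝ), ‖z‖ₑ * ENNReal.ofReal b = ENNReal.ofReal (‖z‖ * b) := fun z b => by
    rw [← ofReal_norm, ENNReal.ofReal_mul (norm_nonneg z)]
  have hnorm : bsNorm ∞ β f ≤ 1 := by
    rw [bsNorm, if_pos rfl]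
    refine iSup_le fun n => ?_
    rw [e, norm_taylorCoeff_rotatedPoly hc, ← ENNReal.ofReal_one]
    refine ENNReal.ofReal_le_ofReal ?_
    split_ifs with hn
    · exact hd n hn
    · simp
  have hle := (hC f ⟨differentiableOn_rotatedPoly c I d _, hnorm.trans_lt ENNReal.one_lt_top⟩).2
  have hle2 := hle.trans (mul_le_mul_right hnorm _)
  rw [bsNorm, if_pos rfl, mul_one] at hle2
  have hle3 := (le_iSup (fun n => ‖taylorCoeff (f ∘ diskAut a) n‖ₑ * ENNReal.ofReal (β n)) m).trans
    hle2
  simp only [e, f, norm_taylorCoeff_rotatedPoly_comp ha hc hca] at hle3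
  rw [← ENNReal.ofReal_coe_nnreal] at hle3
  exact (ENNReal.ofReal_le_ofReal_iff C.coe_nonneg).1 hle3

/-! ### Unboundedness -/

/-- Summing over n and exchanging the sums compares (C + 1)∑g with C∑g, whatever the weight g. -/
lemma not_forall_sum_mul_le {A : ℕ → ℕ → ℝ} {g : ℕ → ℝ} (hg : ∀ n, 0 < g n) {C : ℝ}
    {I : Finset ℕ} (hI : I.Nonempty) (hrow : ∀ m ∈ I, C + 1 ≤ ∑ n ∈ I, A m n) :
    ¬ ∀ n ∈ I, ∑ m ∈ I, A m n * g m ≤ C * g n := fun hcol => by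
  have h1 := Finset.sum_le_sum hcol
  rw [Finset.sum_comm, ← Finset.mul_sum] at h1
  have h2 : (C + 1) * ∑ m ∈ I, g m ≤ ∑ m ∈ I, ∑ n ∈ I, A m n * g m := by
    rw [Finset.mul_sum]
    refine Finset.sum_le_sum fun m hm => ?_
    rw [← Finset.sum_mul]
    exact mul_le_mul_of_nonneg_right (hrow m hm) (hg m).le
  have h3 : 0 < ∑ m ∈ I, g m := Finset.sum_pos (fun m _ => hg m) hI
  linarith

lemma sign_mul_abs_rpow_mul {x q : ℝ} (hq : 1 ≤ q) :
    (SignType.sign x : ℝ) * |x| ^ (q - 1) * x = |x| ^ q := by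
  rcases eq_or_ne x 0 with rfl | hx
  · simp [Real.zero_rpow (by linarith : q ≠ 0)]
  · rw [mul_right_comm, sign_mul_self, Real.rpow_sub_one (abs_ne_zero.2 hx)]
    field_simp

lemma abs_sign_le_one (x : ℝ) : |(SignType.sign x : ℝ)| ≤ 1 := by
  rcases lt_trichotomy x 0 with h | rfl | h <;> simp [*]

/-- Test polynomials carrying the signs of row m and moduli 1/β give a Schur inequality for the
transpose, with weight 1/β and q = 1. -/
lemma not_inducesBoundedComp_top {β : ℕ → ℝ} (hβ : ∀ n, 0 < β n) {a : ℂ} (ha : ‖a‖ < 1)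
    (ha0 : a ≠ 0) : ¬ InducesBoundedComp ∞ β (diskAut a) := fun h => by
  obtain ⟨C, -, hC⟩ := h.exists_abs_sum_le ha
  obtain ⟨I, hI, hcol, -⟩ := exists_finset_le_sum_rpow (norm_pos_iff.2 ha0) ha one_pos one_lt_two
    (C + 1)
  refine not_forall_sum_mul_le (A := fun m n => |autCoeff ‖a‖ n m| ^ (1 : ℝ))
    (g := fun n => (β n)⁻¹) (fun n => inv_pos.2 (hβ n)) hI hcol fun m _ => ?_
  have h1 := hC I (fun n => SignType.sign (autCoeff ‖a‖ m n) * (β n)⁻¹) (fun n _ => ?_) m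
  · rw [← div_eq_mul_inv, le_div_iff₀ (hβ m)]
    refine le_trans ?_ h1
    refine mul_le_mul_of_nonneg_right (le_trans (le_of_eq ?_) (le_abs_self _)) (hβ m).le
    refine Finset.sum_congr rfl fun n _ => ?_
    rw [Real.rpow_one, mul_right_comm, sign_mul_self]
  · rw [abs_mul, abs_of_pos (inv_pos.2 (hβ n)), mul_assoc, inv_mul_cancel₀ (hβ n).ne', mul_one]
    exact abs_sign_le_one _

lemma not_inducesBoundedComp_of_lt_two {p : ℝ≥0∞} (hp : 1 ≤ p) (hp2 : p < 2) {β : ℕ → ℝ}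
    (hβ : ∀ n, 0 < β n) {a : ℂ} (ha : ‖a‖ < 1) (ha0 : a ≠ 0) :
    ¬ InducesBoundedComp p β (diskAut a) := fun h => by
  have hpt : p ≠ ∞ := (hp2.trans ENNReal.ofNat_lt_top).ne
  have hq0 : 0 < p.toReal := ENNReal.toReal_pos (zero_lt_one.trans_le hp).ne' hpt
  have hq2 : p.toReal < 2 := by
    have := (ENNReal.toReal_lt_toReal hpt ENNReal.ofNat_ne_top).2 hp2
    simpa using this
  obtain ⟨C, -, hC⟩ := h.exists_sum_le hp hpt hβ ha
  obtain ⟨I, hI, -, hrow⟩ := exists_finset_le_sum_rpow (norm_pos_iff.2 ha0) ha hq0 hq2 (C + 1)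
  refine not_forall_sum_mul_le hβ hI hrow fun n _ => ?_
  -- Monomials suffice as test functions.
  simpa using hC {n} I fun _ => 1

lemma not_inducesBoundedComp_of_two_lt {p : ℝ≥0∞} (hp2 : 2 < p) (hpt : p ≠ ∞) {β : ℕ → ℝ}
    (hβ : ∀ n, 0 < β n) {a : ℂ} (ha : ‖a‖ < 1) (ha0 : a ≠ 0) :
    ¬ InducesBoundedComp p β (diskAut a) := fun h => by
  obtain ⟨C, hC0, hC⟩ := h.exists_sum_le (one_le_two.trans hp2.le) hpt hβ ha
  have hs : 2 < p.toReal := by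
    have := (ENNReal.toReal_lt_toReal ENNReal.ofNat_ne_top hpt).2 hp2
    simpa using this
  set s := p.toReal
  have hs1 : 0 < s - 1 := by linarith
  set q : ℝ := s / (s - 1) with hq
  have hq1 : 1 < q := by rw [hq, one_lt_div hs1]; linarith
  have hq2 : q < 2 := by rw [hq, div_lt_iff₀ hs1]; linarith
  have hqs : (q - 1) * s = q := by rw [hq]; field_simp; ring
  -- This is the dual weight: with it, the Hölder extremal for row m has norm to the power s at most
  -- S and image coefficient S at m. Hence S^s β_m ≤ C S, that is, S ≤ C^(1/(s-1)) γ_m, a Schur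
  -- inequality for the transpose.
  set γ : ℕ → ℝ := fun n => β n ^ (-(s - 1)⁻¹) with hγdef
  have hγ : ∀ n, 0 < γ n := fun n => Real.rpow_pos_of_pos (hβ n) _
  have hγβ : ∀ n, γ n ^ (s - 1) * β n = 1 := fun n => by
    simp only [hγdef]
    rw [← Real.rpow_mul (hβ n).le, neg_mul, inv_mul_cancel₀ hs1.ne', Real.rpow_neg_one,
      inv_mul_cancel₀ (hβ n).ne']
  have hγβ' : ∀ n, γ n ^ s * β n = γ n := fun n => by
    have : γ n ^ s = γ n ^ (s - 1) * γ n := by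
      rw [← Real.rpow_add_one (hγ n).ne', sub_add_cancel]
    rw [this, mul_right_comm, hγβ, one_mul]
  obtain ⟨I, hI, hcol, -⟩ := exists_finset_le_sum_rpow (norm_pos_iff.2 ha0) ha
    (zero_lt_one.trans hq1) hq2 (C ^ (s - 1)⁻¹ + 1)
  refine not_forall_sum_mul_le (A := fun m n => |autCoeff ‖a‖ n m| ^ q) hγ hI hcol fun m _ => ?_
  set S := ∑ n ∈ I, |autCoeff ‖a‖ m n| ^ q * γ n
  have hS0 : 0 ≤ S := Finset.sum_nonneg fun n _ => mul_nonneg (by positivity) (hγ n).le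
  have h1 := hC I {m} fun n =>
    SignType.sign (autCoeff ‖a‖ m n) * |autCoeff ‖a‖ m n| ^ (q - 1) * γ n
  have e1 : ∑ n ∈ I, SignType.sign (autCoeff ‖a‖ m n) * |autCoeff ‖a‖ m n| ^ (q - 1) * γ n *
      autCoeff ‖a‖ m n = S :=
    Finset.sum_congr rfl fun n _ => by rw [mul_right_comm, sign_mul_abs_rpow_mul hq1.le]
  have e2 : ∑ n ∈ I, |SignType.sign (autCoeff ‖a‖ m n) * |autCoeff ‖a‖ m n| ^ (q - 1) * γ n| ^ s *
      β n ≤ S := by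
    refine Finset.sum_le_sum fun n _ => ?_
    have b : |SignType.sign (autCoeff ‖a‖ m n) * |autCoeff ‖a‖ m n| ^ (q - 1) * γ n| ≤
        |autCoeff ‖a‖ m n| ^ (q - 1) * γ n := by
      rw [mul_assoc, abs_mul, abs_of_nonneg (mul_nonneg (by positivity) (hγ n).le)]
      exact mul_le_of_le_one_left (mul_nonneg (by positivity) (hγ n).le) (abs_sign_le_one _)
    calc _ ≤ (|autCoeff ‖a‖ m n| ^ (q - 1) * γ n) ^ s * β n :=
          mul_le_mul_of_nonneg_right (Real.rpow_le_rpow (abs_nonneg _) b (by linarith)) (hβ n).le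
      _ = _ := by
          rw [Real.mul_rpow (by positivity) (hγ n).le, ← Real.rpow_mul (abs_nonneg _), hqs,
            mul_assoc, hγβ']
  rw [Finset.sum_singleton, e1, abs_of_nonneg hS0] at h1
  have h2 : S ^ s * β m ≤ C * S := h1.trans (mul_le_mul_of_nonneg_left e2 hC0)
  rcases hS0.eq_or_lt with hS | hS
  · rw [← hS]
    exact mul_nonneg (by positivity) (hγ m).le
  have h3 : S ^ (s - 1) ≤ C * γ m ^ (s - 1) := by
    have e3 : S ^ s = S ^ (s - 1) * S := by rw [← Real.rpow_add_one hS.ne', sub_add_cancel]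
    have h4 : S ^ (s - 1) * β m ≤ C := by
      refine le_of_mul_le_mul_right ?_ hS
      rwa [mul_right_comm, ← e3]
    calc S ^ (s - 1) = S ^ (s - 1) * β m * γ m ^ (s - 1) := by
          rw [mul_assoc, mul_comm (β m), hγβ, mul_one]
      _ ≤ _ := mul_le_mul_of_nonneg_right h4 (Real.rpow_nonneg (hγ m).le _)
  have h5 := Real.rpow_le_rpow (Real.rpow_nonneg hS0 _) h3 (inv_nonneg.2 hs1.le)
  rwa [Real.mul_rpow hC0 (Real.rpow_nonneg (hγ m).le _), ← Real.rpow_mul hS0,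
    ← Real.rpow_mul (hγ m).le, mul_inv_cancel₀ hs1.ne', Real.rpow_one, Real.rpow_one] at h5

/-- No disk automorphism other than a rotation induces a bounded composition operator on
`h^p(β)`, for any positive weight `β`, if `p ≠ 2`. -/
lemma not_inducesBoundedComp_diskAut {p : ℝ≥0∞} (hp : 1 ≤ p) (hp2 : p ≠ 2) {β : ℕ → ℝ}
    (hβ : ∀ n, 0 < β n) {a : ℂ} (ha : ‖a‖ < 1) (ha0 : a ≠ 0) :
    ¬ InducesBoundedComp p β (diskAut a) := by
  rcases eq_or_ne p ∞ with rfl | hpt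
  · exact not_inducesBoundedComp_top hβ ha ha0
  rcases lt_or_gt_of_ne hp2 with h | h
  · exact not_inducesBoundedComp_of_lt_two hp h hβ ha ha0
  · exact not_inducesBoundedComp_of_two_lt h hpt hβ ha ha0

end BeurlingSobolev

theorem theorem3p1 (p : ENNReal) (hp : 1 ≤ p) (hp2 : p ≠ 2) :
    (∀ a : ℂ, ‖a‖ < 1 → a ≠ 0 →
      ¬ BeurlingSobolev.InducesBoundedComp p (fun _ => 1) (BeurlingSobolev.diskAut a)) ∧
    (∀ β : ℕ → ℝ, BeurlingSobolev.IsWeight β →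
      ∀ a : ℂ, ‖a‖ < 1 → a ≠ 0 →
        ¬ BeurlingSobolev.InducesBoundedComp p β (BeurlingSobolev.diskAut a)) :=
  ⟨fun _ ha ha0 =>
    BeurlingSobolev.not_inducesBoundedComp_diskAut hp hp2 (fun _ => one_pos) ha ha0,
  fun _ hβ _ ha ha0 => BeurlingSobolev.not_inducesBoundedComp_diskAut hp hp2 hβ.1 ha ha0⟩
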